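/- Let $P$ be a complex polynomial of degree $d\ge 2$. Let $\varphi$ be a Böttcher map of $P$ at $\infty$, that is, an injective holomorphic map on a neighbourhood of $\infty$ in $\widehat{\mathbb C}$ with $\varphi(\infty)=\infty$ and $\varphi(w^d)=P(\varphi(w))$ whenever both $w$ and $w^d$ lie in the domain of $\varphi$. Fix $R>1$ such that the domain of $\varphi$ contains $\{w\in\widehat{\mathbb C}: |w|\ge R\}$. For $n\ge 0$ put $R_n=R^{d^n}$, let $\gamma_n=\varphi(\{|w|=R_n\})$, and let $D_n$ be the bounded connected component of $\mathbb C\setminus\gamma_n$. Then there is a sequence $(b_n)_{n\ge 0}$ of Blaschke products of degree $d$ on the unit disk $\mathbb D$ such that: 1. $(b_n)$ is uniformly hyperbolic: each $b_n$ has the form $$b_n(z)=z\prod_{k=1}^{d-1}\frac{z-a_k^n}{1-\overline{a_k^n}\,z},\qquad z\in\mathbb D,$$ and there is $r\in(0,1)$ with $|a_k^n|<r$ for all $n\ge 0$ and $1\le k\le d-1$; 2. $(b_n)$ is conformally equivalent to $(P|_{D_n})$: $P$ maps the open set $D_n$ into $D_{n+1}$ for every $n\ge 0$, and there are biholomorphic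 maps $h_n\colon D_n\to\mathbb D$ such that $b_n=h_{n+1}\circ P\circ h_n^{-1}$ on $\mathbb D$ for all $n\ge 0$. -/

import Mathlib

namespace PolyBlaschke

/-- A sequence of holomorphic maps `f n : U n → U (n + 1)` between open subsets of `ℂ`
(each map is represented by a total function of which only the restriction to `U n` matters). -/
structure IsHolomorphicSequence (U : ℕ → Set ℂ) (f : ℕ → ℂ → ℂ) : Prop where
  isOpen : ∀ n, IsOpen (U n)
  holomorphic : ∀ n, DifferentiableOn ℂ (f n) (U n)
  mapsTo : ∀ n, Set.MapsTo (f n) (U n) (U (n + 1))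

/-- `h` restricts to a conformal isomorphism (a biholomorphic map) of the open set `U` onto `V`. -/
structure IsConformalIso (h : ℂ → ℂ) (U V : Set ℂ) : Prop where
  holomorphic : DifferentiableOn ℂ h U
  bijOn : Set.BijOn h U V

/-- The sequences `f n : U n → U (n + 1)` and `g n : V n → V (n + 1)` are conformally equivalent:
there are conformal isomorphisms `h n : U n → V n` with `g n = h (n + 1) ∘ f n ∘ (h n)⁻¹`. -/
def ConformallyEquivalent (U : ℕ → Set ℂ) (f : ℕ → ℂ → ℂ) (V : ℕ → Set ℂ) (g : ℕ → ℂ → ℂ) :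
    Prop :=
  IsHolomorphicSequence U f ∧ IsHolomorphicSequence V g ∧
    ∃ h : ℕ → ℂ → ℂ, (∀ n, IsConformalIso (h n) (U n) (V n)) ∧
      ∀ n, ∀ z ∈ U n, g n (h n z) = h (n + 1) (f n z)

/-- The Möbius factor `(z - a) / (1 - conj a * z)`. -/
noncomputable def blaschkeFactor (a z : ℂ) : ℂ := (z - a) / (1 - (starRingEnd ℂ) a * z)

/-- `b` is, on the unit disk, a finite Blaschke product of degree `d`. -/
def IsBlaschkeProduct (d : ℕ) (b : ℂ → ℂ) : Prop :=
  ∃ (θ : ℝ) (a : Fin d → ℂ), (∀ k, ‖a k‖ < 1) ∧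
    ∀ z ∈ Metric.ball (0 : ℂ) 1,
      b z = Complex.exp (θ * Complex.I) * ∏ k, blaschkeFactor (a k) z

/-- `b` is, on the unit disk, the hyperbolic Blaschke product of degree `d ≥ 2` fixing `0`, of the
form `z * ∏ (z - a k) / (1 - conj (a k) * z)`, with zeros `0` and the `d - 1` points `a k`. -/
structure IsNormalizedBlaschke (d : ℕ) (a : Fin (d - 1) → ℂ) (b : ℂ → ℂ) : Prop where
  two_le : 2 ≤ d
  norm_lt_one : ∀ k, ‖a k‖ < 1
  eq_prod : ∀ z ∈ Metric.ball (0 : ℂ) 1, b z = z * ∏ k, blaschkeFactor (a k) z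

/-- A uniformly hyperbolic sequence of Blaschke products: hyperbolic Blaschke products normalized
to fix `0`, of uniformly bounded degree, with all zeros in a common disk of radius `r < 1`. -/
def UniformlyHyperbolic (b : ℕ → ℂ → ℂ) : Prop :=
  ∃ (deg : ℕ → ℕ) (a : ∀ n, Fin (deg n - 1) → ℂ),
    (∀ n, IsNormalizedBlaschke (deg n) (a n) (b n)) ∧
    (∃ N, ∀ n, deg n ≤ N) ∧
    ∃ r : ℝ, 0 < r ∧ r < 1 ∧ ∀ n k, ‖a n k‖ < r

/-- `φ`, defined on the open set `Ω` (with `Ω ∪ {∞}` a neighbourhood of `∞`), is a Böttcher map of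
`P` at `∞`: it is injective and holomorphic, `φ(∞) = ∞`, and `φ (w ^ d) = P (φ w)`,
where `d = deg P`. -/
structure IsBottcherMap (P : Polynomial ℂ) (Ω : Set ℂ) (φ : ℂ → ℂ) : Prop where
  isOpen : IsOpen Ω
  nhds_infty : Ω ∈ Filter.cocompact ℂ
  holomorphic : DifferentiableOn ℂ φ Ω
  injOn : Set.InjOn φ Ω
  tendsto_infty : Filter.Tendsto φ (Filter.cocompact ℂ) (Filter.cocompact ℂ)
  conj : ∀ w ∈ Ω, w ^ P.natDegree ∈ Ω → φ (w ^ P.natDegree) = P.eval (φ w)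

/-- The interior of a closed curve `γ`: the points off `γ` lying in a bounded connected component
of `ℂ \ γ` (for a Jordan curve there is exactly one such component). -/
def curveInterior (γ : Set ℂ) : Set ℂ :=
  {z | z ∉ γ ∧ Bornology.IsBounded (connectedComponentIn γᶜ z)}

/-- The equipotential domain `D n = int (φ (S_{R_n}))` with `R_n = R ^ (d ^ n)`. -/
def equipotentialDomain (φ : ℂ → ℂ) (d : ℕ) (R : ℝ) (n : ℕ) : Set ℂ :=
  curveInterior (φ '' Metric.sphere (0 : ℂ) (R ^ (d ^ n)))

end PolyBlaschke

open Set Filter Metric Topology MeasureTheory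

namespace PolyBlaschke

/-! ### Möbius factors of the disk -/

/-! Let `D n` be the domain inside the `n`-th equipotential, and let `d = deg P`. The Böttcher
equation gives `P ⁻¹ (D (n + 1)) = D n`: a point `φ v` outside `D (n + 1)` has the `d` distinct
preimages `φ w` with `w ^ d = v`, and a polynomial of degree `d` has no others. So `P : D n → D (n +
1)` is proper of degree `d`. A fixed point `p` of `P` lies in every `D n`, because outside `D 0` the
polynomial strictly increases the modulus of the Böttcher coordinate.

Take Riemann maps `h n : D n → 𝔻` with `h n p = 0`. In these coordinates `P` is a unimodular
constant `c n` times the product of the Möbius factors at the points `h n q`, where `q` runs over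
the roots of `P - p` with multiplicity: after division by these factors a zero-free function remains
whose modulus tends to `1` at the circle, hence a constant (`exists_eq_prod_blaschkeFactor`). The
root `q = p` supplies the factor `z`. The other roots do not depend on `n` and lie in `D 0`, so the
Schwarz lemma for `D 0 ⊆ D n` gives `|h n q| ≤ |h 0 q|`; this is the uniform hyperbolicity. Rotating
the `h n` recursively removes the constants `c n`.

The Riemann maps come from Koebe's extremal argument, which needs holomorphic square roots on `D n`,
hence primitives there. Cauchy's formula over the curve `φ (|w| = σ)` writes a holomorphic function
as a Cauchy integral. Pushing its poles out along `φ (t * w)` changes it by an exact function, and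
once the poles are outside a disk containing the domain the remaining integral is holomorphic on
that disk, so exact. The Jordan curve theorem is not used: the injective map `φ` on the exterior
determines both sides of the curve. -/

theorem one_sub_conj_mul_ne_zero {a z : ℂ} (ha : ‖a‖ < 1) (hz : ‖z‖ ≤ 1) :
    1 - (starRingEnd ℂ) a * z ≠ 0 := by
  intro h
  have h1 : ‖(starRingEnd ℂ) a * z‖ = 1 := by rw [← sub_eq_zero.1 h]; simp
  rw [norm_mul, RCLike.norm_conj] at h1
  nlinarith [norm_nonneg a, norm_nonneg z]

theorem one_sub_norm_blaschkeFactor_sq {a z : ℂ} (ha : ‖a‖ < 1) (hz : ‖z‖ < 1) :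
    1 - ‖blaschkeFactor a z‖ ^ 2 =
      (1 - ‖a‖ ^ 2) * (1 - ‖z‖ ^ 2) / ‖1 - (starRingEnd ℂ) a * z‖ ^ 2 := by
  have h0 : ‖1 - (starRingEnd ℂ) a * z‖ ^ 2 ≠ 0 :=
    pow_ne_zero _ (norm_ne_zero_iff.2 (one_sub_conj_mul_ne_zero ha hz.le))
  rw [blaschkeFactor, norm_div, div_pow, eq_div_iff h0, sub_mul, div_mul_cancel₀ _ h0]
  simp only [Complex.sq_norm, Complex.normSq_apply, Complex.sub_re, Complex.sub_im, Complex.mul_re,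
    Complex.mul_im, Complex.conj_re, Complex.conj_im, Complex.one_re, Complex.one_im]
  ring

theorem norm_blaschkeFactor_lt_one {a z : ℂ} (ha : ‖a‖ < 1) (hz : ‖z‖ < 1) :
    ‖blaschkeFactor a z‖ < 1 := by
  have h := one_sub_norm_blaschkeFactor_sq ha hz
  have h0 : 0 < ‖1 - (starRingEnd ℂ) a * z‖ ^ 2 :=
    pow_pos (norm_pos_iff.2 (one_sub_conj_mul_ne_zero ha hz.le)) _
  have h1 : 0 < (1 - ‖a‖ ^ 2) * (1 - ‖z‖ ^ 2) / ‖1 - (starRingEnd ℂ) a * z‖ ^ 2 := by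
    refine div_pos (mul_pos ?_ ?_) h0 <;> nlinarith [norm_nonneg a, norm_nonneg z]
  nlinarith [norm_nonneg (blaschkeFactor a z)]

theorem blaschkeFactor_neg_blaschkeFactor {a z : ℂ} (ha : ‖a‖ < 1) (hz : ‖z‖ < 1) :
    blaschkeFactor (-a) (blaschkeFactor a z) = z := by
  have h0 := one_sub_conj_mul_ne_zero ha hz.le
  have h2 := one_sub_conj_mul_ne_zero (a := -a) (by simpa using ha)
    (norm_blaschkeFactor_lt_one ha hz).le
  have hB : blaschkeFactor a z * (1 - (starRingEnd ℂ) a * z) = z - a := div_mul_cancel₀ _ h0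
  rw [blaschkeFactor, div_eq_iff h2, map_neg]
  linear_combination hB

theorem blaschkeFactor_self (a : ℂ) : blaschkeFactor a a = 0 := by simp [blaschkeFactor]

theorem differentiableOn_blaschkeFactor {a : ℂ} (ha : ‖a‖ < 1) :
    DifferentiableOn ℂ (blaschkeFactor a) (ball 0 1) := by
  intro z hz
  have h0 := one_sub_conj_mul_ne_zero ha (mem_ball_zero_iff.1 hz).le
  refine DifferentiableAt.differentiableWithinAt ?_
  change DifferentiableAt ℂ (fun z => (z - a) / (1 - (starRingEnd ℂ) a * z)) z
  fun_prop (disch := exact h0)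

theorem mapsTo_blaschkeFactor {a : ℂ} (ha : ‖a‖ < 1) :
    MapsTo (blaschkeFactor a) (ball 0 1) (ball 0 1) := fun _ hz =>
  mem_ball_zero_iff.2 (norm_blaschkeFactor_lt_one ha (mem_ball_zero_iff.1 hz))

theorem injOn_blaschkeFactor {a : ℂ} (ha : ‖a‖ < 1) : InjOn (blaschkeFactor a) (ball 0 1) := by
  intro x hx y hy h
  rw [← blaschkeFactor_neg_blaschkeFactor ha (mem_ball_zero_iff.1 hx), h,
    blaschkeFactor_neg_blaschkeFactor ha (mem_ball_zero_iff.1 hy)]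

theorem blaschkeFactor_eq_zero_iff {a z : ℂ} (ha : ‖a‖ < 1) (hz : ‖z‖ < 1) :
    blaschkeFactor a z = 0 ↔ z = a := by
  rw [blaschkeFactor, div_eq_zero_iff, or_iff_left (one_sub_conj_mul_ne_zero ha hz.le),
    sub_eq_zero]

/-- The filter `comap (‖·‖) (𝓝[<] 1)` expresses approach to the unit circle from inside, uniformly
in the argument. In the identity for `1 - ‖blaschkeFactor a z‖ ^ 2` the denominator is at least `(1
- ‖a‖) ^ 2`, while `1 - ‖z‖ ^ 2` tends to `0`. -/
theorem tendsto_norm_blaschkeFactor {a : ℂ} (ha : ‖a‖ < 1) :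
    Tendsto (fun z => ‖blaschkeFactor a z‖) (comap (fun z : ℂ => ‖z‖) (𝓝[<] 1)) (𝓝 1) := by
  have hnorm : Tendsto (fun z : ℂ => ‖z‖) (comap (fun z : ℂ => ‖z‖) (𝓝[<] 1)) (𝓝 1) :=
    tendsto_comap.mono_right nhdsWithin_le_nhds
  have hlow : Tendsto (fun z : ℂ => 1 - (1 - ‖a‖ ^ 2) * (1 - ‖z‖ ^ 2) / (1 - ‖a‖) ^ 2)
      (comap (fun z : ℂ => ‖z‖) (𝓝[<] 1)) (𝓝 1) := by
    have : Tendsto (fun t : ℝ => 1 - (1 - ‖a‖ ^ 2) * (1 - t ^ 2) / (1 - ‖a‖) ^ 2) (𝓝 1) (𝓝 1) := by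
      have h : Continuous fun t : ℝ => 1 - (1 - ‖a‖ ^ 2) * (1 - t ^ 2) / (1 - ‖a‖) ^ 2 := by
        fun_prop
      simpa using h.tendsto 1
    exact this.comp hnorm
  have hev : ∀ᶠ z : ℂ in comap (fun z : ℂ => ‖z‖) (𝓝[<] 1), ‖z‖ < 1 :=
    tendsto_comap.eventually self_mem_nhdsWithin
  have hsq : Tendsto (fun z => ‖blaschkeFactor a z‖ ^ 2) (comap (fun z : ℂ => ‖z‖) (𝓝[<] 1))
      (𝓝 1) := by
    refine tendsto_of_tendsto_of_tendsto_of_le_of_le' hlow tendsto_const_nhds ?_ ?_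
    · filter_upwards [hev] with z hz
      have h := one_sub_norm_blaschkeFactor_sq ha hz
      have h1 : 1 - ‖a‖ ≤ ‖1 - (starRingEnd ℂ) a * z‖ := by
        have h2 := norm_sub_norm_le (1 : ℂ) ((starRingEnd ℂ) a * z)
        rw [norm_mul, RCLike.norm_conj, norm_one] at h2
        nlinarith [norm_nonneg a]
      have h3 : (1 - ‖a‖) ^ 2 ≤ ‖1 - (starRingEnd ℂ) a * z‖ ^ 2 :=
        pow_le_pow_left₀ (by linarith) h1 2
      have h4 : 0 ≤ (1 - ‖a‖ ^ 2) * (1 - ‖z‖ ^ 2) := by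
        refine mul_nonneg ?_ ?_ <;> nlinarith [norm_nonneg a, norm_nonneg z]
      have h5 := div_le_div_of_nonneg_left h4 (pow_pos (sub_pos.2 ha) 2) h3
      linarith
    · filter_upwards [hev] with z hz
      exact pow_le_one₀ (norm_nonneg _) (norm_blaschkeFactor_lt_one ha hz).le
  have := hsq.sqrt
  simpa [Real.sqrt_sq (norm_nonneg _)] using this

/-! ### Normal families and Hurwitz' theorem -/

theorem norm_sub_le_of_norm_le_one {f : ℂ → ℂ} {c z : ℂ} {r : ℝ}
    (hf : DifferentiableOn ℂ f (ball c r)) (hb : ∀ w ∈ ball c r, ‖f w‖ ≤ 1) (hz : z ∈ ball c r) :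
    ‖f z - f c‖ ≤ 2 / r * ‖z - c‖ := by
  have hr : 0 < r := nonempty_ball.1 ⟨z, hz⟩
  have := Complex.dist_le_div_mul_dist_of_mapsTo_ball (R₂ := 2) hf (fun w hw => ?_) hz
  · simpa [dist_eq_norm] using this
  · rw [mem_closedBall, dist_eq_norm]
    linarith [norm_sub_le (f w) (f c), hb w hw, hb c (mem_ball_self hr)]

/-- The Schwarz lemma makes a family bounded by `1` locally equi-Lipschitz, and equicontinuity
upgrades pointwise to locally uniform convergence. The filter is arbitrary so that an ultrafilter
can be used. -/
theorem tendstoLocallyUniformlyOn_of_norm_le_one {ι : Type*} {l : Filter ι} [l.NeBot]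
    {F : ι → ℂ → ℂ} {f : ℂ → ℂ} {U : Set ℂ} (hU : IsOpen U)
    (hF : ∀ i, DifferentiableOn ℂ (F i) U) (hb : ∀ i, ∀ z ∈ U, ‖F i z‖ ≤ 1)
    (hlim : ∀ z ∈ U, Tendsto (fun i => F i z) l (𝓝 (f z))) :
    TendstoLocallyUniformlyOn F f l U := by
  rw [Metric.tendstoLocallyUniformlyOn_iff]
  intro ε hε z hz
  obtain ⟨r, hr, hrU⟩ := Metric.isOpen_iff.1 hU z hz
  have hδ : 0 < min r (ε * r / 8) := by positivity
  refine ⟨ball z (min r (ε * r / 8)), mem_nhdsWithin_of_mem_nhds (ball_mem_nhds z hδ), ?_⟩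
  have hlip : ∀ i, ∀ y ∈ ball z (min r (ε * r / 8)), ‖F i y - F i z‖ ≤ ε / 4 := by
    intro i y hy
    have hy' := mem_ball_iff_norm.1 hy
    refine (norm_sub_le_of_norm_le_one ((hF i).mono hrU) (fun w hw => hb i w (hrU hw))
      (ball_subset_ball (min_le_left _ _) hy)).trans ?_
    have h1 : ‖y - z‖ ≤ ε * r / 8 := hy'.le.trans (min_le_right _ _)
    calc 2 / r * ‖y - z‖ ≤ 2 / r * (ε * r / 8) := by gcongr
      _ = ε / 4 := by field_simp; norm_num
  have hlip' : ∀ y ∈ ball z (min r (ε * r / 8)), ‖f y - f z‖ ≤ ε / 4 := fun y hy =>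
    le_of_tendsto (((hlim y (hrU (ball_subset_ball (min_le_left _ _) hy))).sub (hlim z hz)).norm)
      (Eventually.of_forall fun i => hlip i y hy)
  filter_upwards [Metric.tendsto_nhds.1 (hlim z hz) (ε / 4) (by positivity)] with i hi y hy
  calc dist (f y) (F i y) ≤ dist (f y) (f z) + dist (f z) (F i z) + dist (F i z) (F i y) :=
        dist_triangle4 _ _ _ _
    _ < ε := by
        have h1 := hlip i y hy
        have h2 := hlip' y hy
        rw [← dist_eq_norm] at h1 h2
        linarith [dist_comm (f z) (F i z), dist_comm (F i z) (F i y)]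

/-- **Hurwitz' theorem**: a locally uniform limit of injective holomorphic functions is injective
as soon as it is not constant. -/
theorem injOn_of_tendstoLocallyUniformlyOn {ι : Type*} {l : Filter ι} [l.NeBot]
    {F : ι → ℂ → ℂ} {f : ℂ → ℂ} {U : Set ℂ} (hU : IsOpen U) (hUc : IsPreconnected U)
    (hF : ∀ i, DifferentiableOn ℂ (F i) U) (hinj : ∀ i, InjOn (F i) U)
    (hlim : TendstoLocallyUniformlyOn F f l U)
    (hnc : ∃ p ∈ U, ∃ q ∈ U, f p ≠ f q) : InjOn f U := by
  have hf : DifferentiableOn ℂ f U := hlim.differentiableOn (Eventually.of_forall hF) hU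
  intro a ha b hb hab
  by_contra hne
  have hiso : ∀ᶠ z in 𝓝[≠] a, f z ≠ f a := by
    by_contra hcon
    have hfr : ∃ᶠ z in 𝓝[≠] a, f z = f a := by
      rw [not_eventually] at hcon
      exact hcon.mono fun z hz => not_not.1 hz
    have := (hf.analyticOnNhd hU).eqOn_of_preconnected_of_frequently_eq analyticOnNhd_const hUc ha
      hfr
    obtain ⟨p, hp, q, hq, hpq⟩ := hnc
    exact hpq ((this hp).trans (this hq).symm)
  have hev : ∀ᶠ z in 𝓝 a, z ≠ b ∧ z ∈ U ∧ (z ≠ a → f z ≠ f a) :=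
    (isOpen_ne.eventually_mem hne).and
      ((hU.eventually_mem ha).and (eventually_nhdsWithin_iff.1 hiso))
  obtain ⟨r, hr, hrU⟩ := (nhds_basis_closedBall.mem_iff).1 hev
  have hcU : closedBall a r ⊆ U := fun z hz => (hrU hz).2.1
  obtain ⟨z₀, hz₀, hmin⟩ := (isCompact_sphere a r).exists_isMinOn
    (NormedSpace.sphere_nonempty.2 hr.le)
    ((hf.continuousOn.mono (sphere_subset_closedBall.trans hcU)).sub
      (continuousOn_const (c := f a))).norm
  set m := ‖f z₀ - f a‖ with hm
  have hmpos : 0 < m := norm_pos_iff.2 (sub_ne_zero.2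
    ((hrU (sphere_subset_closedBall hz₀)).2.2 (ne_of_mem_sphere hz₀ hr.ne')))
  have hK : IsCompact (insert b (closedBall a r)) := (isCompact_closedBall a r).insert b
  have hKU : insert b (closedBall a r) ⊆ U := insert_subset hb hcU
  have hun := (tendstoLocallyUniformlyOn_iff_forall_isCompact hU).1 hlim _ hKU hK
  -- With error `m / 8` at each point, `|F i - F i a| ≥ m / 2` on the circle, so the image of the
  -- closed disk covers the ball of radius `m / 4` about `F i a`. That ball contains `F i b`, since
  -- `f a = f b`, although `b` lies outside the disk; this contradicts injectivity.
  obtain ⟨i, hi⟩ := ((Metric.tendstoUniformlyOn_iff.1 hun) (m / 8) (by positivity)).exists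
  have hia := hi a (mem_insert_of_mem _ (mem_closedBall_self hr.le))
  have hib := hi b (mem_insert _ _)
  have hsph : ∀ z ∈ sphere a r, m / 2 ≤ ‖F i z - F i a‖ := by
    intro z hz
    have h1 := hi z (mem_insert_of_mem _ (sphere_subset_closedBall hz))
    have h2 : m ≤ ‖f z - f a‖ := hmin hz
    rw [← dist_eq_norm] at h2 ⊢
    have h3 := dist_triangle4 (f z) (F i z) (F i a) (f a)
    rw [dist_comm (F i a) (f a)] at h3
    linarith
  have hsub := (((hF i).mono hcU).diffContOnCl_ball (subset_refl _)).ball_subset_image_closedBall hr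
    hsph (by
      refine Filter.Eventually.frequently (f := 𝓝[≠] a) ?_ |>.filter_mono nhdsWithin_le_nhds
      filter_upwards [self_mem_nhdsWithin, mem_nhdsWithin_of_mem_nhds (hU.mem_nhds ha)] with z hz hzU
      exact fun h => hz (hinj i hzU ha h))
  have hmem : F i b ∈ ball (F i a) (m / 2 / 2) := by
    rw [mem_ball]
    have h3 := dist_triangle4 (F i b) (f b) (f a) (F i a)
    rw [hab, dist_self] at h3
    rw [hab] at hia
    linarith [dist_comm (f b) (F i b)]
  obtain ⟨z, hz, hzb⟩ := hsub hmem
  exact (hrU hz).1 (hinj i (hcU hz) hb hzb)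

/-- The strict form of the Schwarz lemma for maps of the disk which are not injective. -/
theorem norm_lt_norm_of_mapsTo_ball_of_not_injOn {σ : ℂ → ℂ}
    (hd : DifferentiableOn ℂ σ (ball 0 1)) (hmaps : MapsTo σ (ball 0 1) (ball 0 1)) (h0 : σ 0 = 0)
    (hinj : ¬ InjOn σ (ball 0 1)) {z : ℂ} (hz : ‖z‖ < 1) (hz0 : z ≠ 0) : ‖σ z‖ < ‖z‖ := by
  have hmaps' : MapsTo σ (ball 0 1) (closedBall 0 1) := hmaps.mono_right ball_subset_closedBall
  refine lt_of_le_of_ne (Complex.norm_le_norm_of_mapsTo_ball hd hmaps' h0 hz) fun heq => hinj ?_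
  have hzpos : 0 < ‖z‖ := norm_pos_iff.2 hz0
  obtain ⟨C, hC, hE⟩ := Complex.affine_of_mapsTo_ball_of_exists_norm_dslope_eq_div'
    (R₂ := 1) hd (by rwa [h0]) ⟨z, mem_ball_zero_iff.2 hz, by
      rw [dslope_of_ne _ hz0, slope_def_field, h0]
      simp [heq, hzpos.ne']⟩
  have hC0 : C ≠ 0 := by
    rintro rfl
    simp at hC
  intro x hx y hy hxy
  rw [hE hx, hE hy] at hxy
  simpa [h0, hC0] using hxy

/-! ### The Riemann mapping theorem -/

/-- Square roots of nonvanishing holomorphic functions exist on `U`. -/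
def HasHolomorphicSqrt (U : Set ℂ) : Prop :=
  ∀ f : ℂ → ℂ, DifferentiableOn ℂ f U → (∀ z ∈ U, f z ≠ 0) →
    ∃ g : ℂ → ℂ, DifferentiableOn ℂ g U ∧ ∀ z ∈ U, g z ^ 2 = f z

/-- An injective map of `U` into the disk which is not onto can be improved. -/
theorem exists_norm_lt_of_notMem_image {U : Set ℂ} (hs : HasHolomorphicSqrt U) {p q : ℂ}
    (hp : p ∈ U) (hq : q ∈ U) (hpq : p ≠ q) {f : ℂ → ℂ} (hf : DifferentiableOn ℂ f U)
    (hinj : InjOn f U) (hmaps : MapsTo f U (ball 0 1)) (hfp : f p = 0) {w : ℂ}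
    (hw : w ∈ ball (0 : ℂ) 1) (hwf : w ∉ f '' U) :
    ∃ F : ℂ → ℂ, DifferentiableOn ℂ F U ∧ InjOn F U ∧ MapsTo F U (ball 0 1) ∧ F p = 0 ∧
      ‖f q‖ < ‖F q‖ := by
  have hw1 : ‖w‖ < 1 := mem_ball_zero_iff.1 hw
  have hw1' : ‖-w‖ < 1 := by simpa using hw1
  obtain ⟨g, hg, hg2⟩ := hs (fun z => blaschkeFactor w (f z))
    ((differentiableOn_blaschkeFactor hw1).comp hf hmaps) (fun z hz h =>
      hwf ⟨z, hz, (blaschkeFactor_eq_zero_iff hw1 (mem_ball_zero_iff.1 (hmaps hz))).1 h⟩)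
  have hgmaps : MapsTo g U (ball 0 1) := by
    intro z hz
    have h1 := mem_ball_zero_iff.1 (mapsTo_blaschkeFactor hw1 (hmaps hz))
    rw [← hg2 z hz, norm_pow] at h1
    rw [mem_ball_zero_iff]
    by_contra hcon
    nlinarith [norm_nonneg (g z)]
  have hginj : InjOn g U := by
    intro x hx y hy hxy
    refine hinj hx hy (injOn_blaschkeFactor hw1 (hmaps hx) (hmaps hy) ?_)
    rw [← hg2 x hx, ← hg2 y hy, hxy]
  set c := g p with hc
  have hc1 : ‖c‖ < 1 := mem_ball_zero_iff.1 (hgmaps hp)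
  have hc1' : ‖-c‖ < 1 := by simpa using hc1
  -- The new map is `F = blaschkeFactor c ∘ g`, and `σ` undoes it: `f = σ ∘ F`. The squaring makes
  -- `σ` non-injective, so the strict Schwarz lemma gives `|f q| = |σ (F q)| < |F q|`.
  set σ : ℂ → ℂ := fun z => blaschkeFactor (-w) (blaschkeFactor (-c) z ^ 2) with hσ
  have hsq : MapsTo (fun z : ℂ => z ^ 2) (ball 0 1) (ball 0 1) := by
    intro z hz
    rw [mem_ball_zero_iff] at hz ⊢
    rw [norm_pow]
    exact pow_lt_one₀ (norm_nonneg _) hz two_ne_zero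
  have hσd : DifferentiableOn ℂ σ (ball 0 1) :=
    (differentiableOn_blaschkeFactor hw1').comp
      ((differentiableOn_blaschkeFactor hc1').pow 2)
      (fun z hz => hsq (mapsTo_blaschkeFactor hc1' hz))
  have hσm : MapsTo σ (ball 0 1) (ball 0 1) := fun z hz =>
    mapsTo_blaschkeFactor hw1' (hsq (mapsTo_blaschkeFactor hc1' hz))
  have hσF : ∀ z ∈ U, σ (blaschkeFactor c (g z)) = f z := by
    intro z hz
    simp only [hσ]
    rw [blaschkeFactor_neg_blaschkeFactor hc1 (mem_ball_zero_iff.1 (hgmaps hz)), hg2 z hz,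
      blaschkeFactor_neg_blaschkeFactor hw1 (mem_ball_zero_iff.1 (hmaps hz))]
  have hFp : blaschkeFactor c (g p) = 0 := blaschkeFactor_self _
  have hσ0 : σ 0 = 0 := by
    have h := hσF p hp
    rwa [hFp, hfp] at h
  have hσinj : ¬ InjOn σ (ball 0 1) := by
    intro h
    have ht : (1 / 2 : ℂ) ∈ ball (0 : ℂ) 1 := by simp; norm_num
    have ht' : -(1 / 2 : ℂ) ∈ ball (0 : ℂ) 1 := by simp; norm_num
    have hinv : ∀ t ∈ ball (0 : ℂ) 1, blaschkeFactor (-c) (blaschkeFactor c t) = t := fun t ht =>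
      blaschkeFactor_neg_blaschkeFactor hc1 (mem_ball_zero_iff.1 ht)
    have heq : σ (blaschkeFactor c (1 / 2)) = σ (blaschkeFactor c (-(1 / 2))) := by
      simp only [hσ]
      rw [hinv _ ht, hinv _ ht', neg_sq]
    have := injOn_blaschkeFactor hc1 ht ht'
      (h (mapsTo_blaschkeFactor hc1 ht) (mapsTo_blaschkeFactor hc1 ht') heq)
    norm_num at this
  have hFinj : InjOn (fun z => blaschkeFactor c (g z)) U :=
    (injOn_blaschkeFactor hc1).comp hginj hgmaps
  have hFmaps : MapsTo (fun z => blaschkeFactor c (g z)) U (ball 0 1) :=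
    (mapsTo_blaschkeFactor hc1).comp hgmaps
  refine ⟨fun z => blaschkeFactor c (g z), (differentiableOn_blaschkeFactor hc1).comp hg hgmaps,
    hFinj, hFmaps, hFp, ?_⟩
  have hFq : blaschkeFactor c (g q) ≠ 0 := by
    rw [← hFp]
    exact fun h => hpq (hFinj hq hp h).symm
  have := norm_lt_norm_of_mapsTo_ball_of_not_injOn hσd hσm hσ0 hσinj
    (mem_ball_zero_iff.1 (hFmaps hq)) hFq
  rwa [hσF q hq] at this

/-- **Riemann mapping theorem** for bounded domains on which square roots exist. -/
theorem exists_isConformalIso_ball {U : Set ℂ} (hU : IsOpen U) (hUc : IsPreconnected U)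
    (hb : Bornology.IsBounded U) (hs : HasHolomorphicSqrt U) {p : ℂ} (hp : p ∈ U) :
    ∃ h : ℂ → ℂ, IsConformalIso h U (ball 0 1) ∧ h p = 0 := by
  obtain ⟨q, hq, hqp⟩ : ∃ q ∈ U, q ≠ p := by
    obtain ⟨r, hr, hrU⟩ := Metric.isOpen_iff.1 hU p hp
    refine ⟨p + (r / 2 : ℝ), hrU ?_, ?_⟩
    · rw [mem_ball_iff_norm, add_sub_cancel_left, Complex.norm_real, Real.norm_of_nonneg (by linarith)]
      linarith
    · simpa using hr.ne'
  -- Koebe's extremal problem: maximise `|f q|` over injective maps into the disk that vanish at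
  -- `p`. By the preceding lemma a maximiser must be onto.
  let 𝓕 : Set (ℂ → ℂ) :=
    {f | DifferentiableOn ℂ f U ∧ InjOn f U ∧ MapsTo f U (ball 0 1) ∧ f p = 0}
  let S : Set ℝ := (fun f : ℂ → ℂ => ‖f q‖) '' 𝓕
  have hSb : BddAbove S := by
    refine ⟨1, ?_⟩
    rintro _ ⟨f, hf, rfl⟩
    exact (mem_ball_zero_iff.1 (hf.2.2.1 hq)).le
  have hne : 𝓕.Nonempty := by
    obtain ⟨M, hM⟩ := (hb.subset_ball p)
    have hMp : 0 < M := by simpa using hM hp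
    have hM0 : (M : ℂ) ≠ 0 := by exact_mod_cast hMp.ne'
    refine ⟨fun z => (z - p) / M, ?_, ?_, ?_, by simp⟩
    · fun_prop
    · intro x _ y _ hxy
      simpa [div_left_inj' hM0] using hxy
    · intro z hz
      have := mem_ball_iff_norm.1 (hM hz)
      rw [mem_ball_zero_iff, norm_div, Complex.norm_real, Real.norm_of_nonneg hMp.le,
        div_lt_one hMp]
      exact this
  have hSne : S.Nonempty := hne.image _
  obtain ⟨u, -, hulim, huS⟩ := exists_seq_tendsto_sSup hSne hSb
  choose F hF𝓕 hFq using huS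
  have hFd : ∀ n, DifferentiableOn ℂ (F n) U := fun n => (hF𝓕 n).1
  have hFle : ∀ n, ∀ z ∈ U, ‖F n z‖ ≤ 1 := fun n z hz =>
    (mem_ball_zero_iff.1 ((hF𝓕 n).2.2.1 hz)).le
  -- Along a non-principal ultrafilter every sequence in the closed disk converges, so pointwise
  -- limits exist at all points at once, with no diagonal extraction.
  let l : Ultrafilter ℕ := hyperfilter ℕ
  have hlim : ∀ z ∈ U, ∃ y, Tendsto (fun n => F n z) l (𝓝 y) := by
    intro z hz
    obtain ⟨y, -, hy⟩ := (isCompact_closedBall (0 : ℂ) 1).ultrafilter_le_nhds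
      (l.map fun n => F n z) (by
        rw [le_principal_iff]
        exact Filter.Eventually.of_forall (f := (l : Filter ℕ)) fun n =>
          mem_closedBall_zero_iff.2 (hFle n z hz))
    exact ⟨y, hy⟩
  choose! f hf using hlim
  have hloc := tendstoLocallyUniformlyOn_of_norm_le_one (l := (l : Filter ℕ)) hU hFd hFle hf
  have hfd : DifferentiableOn ℂ f U := hloc.differentiableOn (Eventually.of_forall hFd) hU
  have hfp : f p = 0 := by
    refine tendsto_nhds_unique (hf p hp) ?_
    simp only [fun n => (hF𝓕 n).2.2.2]
    exact tendsto_const_nhds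
  have hl : (l : Filter ℕ) ≤ atTop := Nat.hyperfilter_le_atTop
  have hfq : ‖f q‖ = sSup S := by
    refine tendsto_nhds_unique (hf q hq).norm ?_
    simp only [hFq]
    exact hulim.mono_left hl
  have hpos : 0 < ‖f q‖ := by
    obtain ⟨g, hg⟩ := hne
    have h1 : g q ≠ 0 := fun h => hqp (hg.2.1 hq hp (h.trans hg.2.2.2.symm))
    rw [hfq]
    exact (norm_pos_iff.2 h1).trans_le (le_csSup hSb ⟨g, hg, rfl⟩)
  have hpq : f p ≠ f q := by
    rw [hfp]
    exact (norm_pos_iff.1 hpos).symm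
  have hinj : InjOn f U := injOn_of_tendstoLocallyUniformlyOn hU hUc hFd
    (fun n => (hF𝓕 n).2.1) hloc ⟨p, hp, q, hq, hpq⟩
  have hfle : ∀ z ∈ U, ‖f z‖ ≤ 1 := fun z hz =>
    le_of_tendsto (hf z hz).norm (Eventually.of_forall fun n => hFle n z hz)
  have hmaps : MapsTo f U (ball 0 1) := by
    intro z hz
    rw [mem_ball_zero_iff]
    refine lt_of_le_of_ne (hfle z hz) fun heq => hpq ?_
    have := Complex.eqOn_of_isPreconnected_of_isMaxOn_norm hUc hU hfd hz
      (fun y hy => by simpa [heq] using hfle y hy)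
    exact (this hp).trans (this hq).symm
  refine ⟨f, ⟨hfd, hmaps, hinj, ?_⟩, hfp⟩
  intro w hw
  by_contra hwf
  obtain ⟨G, hG1, hG2, hG3, hG4, hG5⟩ :=
    exists_norm_lt_of_notMem_image hs hp hq hqp.symm hfd hinj hmaps hfp hw hwf
  have : ‖G q‖ ≤ sSup S := le_csSup hSb ⟨G, ⟨hG1, hG2, hG3, hG4⟩, rfl⟩
  linarith

/-! ### Injective holomorphic functions -/

theorem isOpen_image_of_injOn {f : ℂ → ℂ} {U V : Set ℂ} (hU : IsOpen U)
    (hf : DifferentiableOn ℂ f U) (hinj : InjOn f U) (hV : IsOpen V) (hVU : V ⊆ U) :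
    IsOpen (f '' V) := by
  rw [isOpen_iff_mem_nhds]
  rintro _ ⟨a, ha, rfl⟩
  have haU := hVU ha
  refine ((hf.analyticOnNhd hU) a haU).eventually_constant_or_nhds_le_map_nhds.resolve_left
    (fun h => ?_) (image_mem_map (hV.mem_nhds ha))
  have h1 : ∀ᶠ z in 𝓝[≠] a, z = a := by
    filter_upwards [h.filter_mono nhdsWithin_le_nhds,
      mem_nhdsWithin_of_mem_nhds (hU.mem_nhds haU)] with z hz hzU
    exact hinj hzU haU hz
  obtain ⟨z, hz, hz'⟩ := (h1.and self_mem_nhdsWithin).exists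
  exact hz' hz

theorem continuousOn_of_leftInvOn {f g : ℂ → ℂ} {U : Set ℂ} (hU : IsOpen U)
    (hf : DifferentiableOn ℂ f U) (hinj : InjOn f U) (hg : LeftInvOn g f U) :
    ContinuousOn g (f '' U) := by
  rw [_root_.continuousOn_iff']
  intro t ht
  refine ⟨f '' (U ∩ t), isOpen_image_of_injOn hU hf hinj (hU.inter ht) inter_subset_left, ?_⟩
  ext y
  constructor
  · rintro ⟨hy, x, hx, rfl⟩
    rw [mem_preimage, hg hx] at hy
    exact ⟨⟨x, ⟨hx, hy⟩, rfl⟩, x, hx, rfl⟩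
  · rintro ⟨⟨x, hx, rfl⟩, -⟩
    exact ⟨by rw [mem_preimage, hg hx.1]; exact hx.2, x, hx.1, rfl⟩

/-- The inverse `g` is continuous, and differentiable at `f z` whenever `deriv f z ≠ 0`. Zeros of
`deriv f` are isolated, so a possible singularity of `g` at `f a` is removable. The chain rule for
`g ∘ f = id` then excludes `deriv f a = 0`. -/
theorem deriv_ne_zero_and_differentiableAt_of_injOn {f g : ℂ → ℂ} {U : Set ℂ} (hU : IsOpen U)
    (hf : DifferentiableOn ℂ f U) (hinj : InjOn f U) (hg : LeftInvOn g f U) {a : ℂ} (ha : a ∈ U) :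
    deriv f a ≠ 0 ∧ DifferentiableAt ℂ g (f a) := by
  have hopen : IsOpen (f '' U) := isOpen_image_of_injOn hU hf hinj hU subset_rfl
  have hgc : ContinuousOn g (f '' U) := continuousOn_of_leftInvOn hU hf hinj hg
  have key : ∀ z ∈ U, deriv f z ≠ 0 → DifferentiableAt ℂ g (f z) := by
    intro z hz h0
    have hd := ((hf z hz).differentiableAt (hU.mem_nhds hz)).hasDerivAt
    refine (HasDerivAt.of_local_left_inverse (f := f) (g := g) (f' := deriv f z)
      ?_ ?_ h0 ?_).differentiableAt
    · exact hgc.continuousAt (hopen.mem_nhds ⟨z, hz, rfl⟩)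
    · rwa [hg hz]
    · filter_upwards [hopen.mem_nhds ⟨z, hz, rfl⟩]
      rintro _ ⟨x, hx, rfl⟩
      rw [hg hx]
  have hfan := hf.analyticOnNhd hU
  have hdan : AnalyticAt ℂ (deriv f) a := (hfan a ha).deriv
  have hiso : ∀ᶠ z in 𝓝[≠] a, deriv f z ≠ 0 := by
    refine hdan.eventually_eq_zero_or_eventually_ne_zero.resolve_left fun h => ?_
    obtain ⟨r, hr, hrU⟩ := Metric.mem_nhds_iff.1 (h.and (hU.eventually_mem ha))
    have hconst : ∀ z ∈ ball a r, f z = f a := fun z hz =>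
      isOpen_ball.is_const_of_deriv_eq_zero (convex_ball a r).isPreconnected
        (hf.mono fun y hy => (hrU hy).2) (fun y hy => (hrU hy).1) hz (mem_ball_self hr)
    have h2 : a + (r / 2 : ℝ) ∈ ball a r := by
      rw [mem_ball_iff_norm, add_sub_cancel_left, Complex.norm_real,
        Real.norm_of_nonneg (by linarith)]
      linarith
    have := hinj (hrU h2).2 ha (hconst _ h2)
    simp at this
    exact hr.ne' this
  have hgd : DifferentiableAt ℂ g (f a) := by
    refine (Complex.analyticAt_of_differentiable_on_punctured_nhds_of_continuousAt ?_
      (hgc.continuousAt (hopen.mem_nhds ⟨a, ha, rfl⟩))).differentiableAt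
    obtain ⟨r, hr, hrU⟩ := Metric.mem_nhds_iff.1
      ((eventually_nhdsWithin_iff.1 hiso).and (hU.eventually_mem ha))
    have hop : IsOpen (f '' ball a r) :=
      isOpen_image_of_injOn hU hf hinj isOpen_ball fun y hy => (hrU hy).2
    rw [eventually_nhdsWithin_iff]
    filter_upwards [hop.mem_nhds ⟨a, mem_ball_self hr, rfl⟩]
    rintro _ ⟨z, hz, rfl⟩ hne
    exact key z (hrU hz).2 ((hrU hz).1 fun h => hne (by rw [mem_singleton_iff.1 h]; rfl))
  refine ⟨fun h0 => ?_, hgd⟩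
  have hfd := (hf a ha).differentiableAt (hU.mem_nhds ha)
  have h1 : HasDerivAt (g ∘ f) (deriv g (f a) * deriv f a) a :=
    hgd.hasDerivAt.comp a hfd.hasDerivAt
  have h2 : HasDerivAt (g ∘ f) 1 a := by
    refine (hasDerivAt_id a).congr_of_eventuallyEq ?_
    filter_upwards [hU.mem_nhds ha] with z hz
    exact hg hz
  have := h1.unique h2
  simp [h0] at this

theorem deriv_ne_zero_of_injOn {f : ℂ → ℂ} {U : Set ℂ} (hU : IsOpen U)
    (hf : DifferentiableOn ℂ f U) (hinj : InjOn f U) {a : ℂ} (ha : a ∈ U) : deriv f a ≠ 0 :=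
  (deriv_ne_zero_and_differentiableAt_of_injOn hU hf hinj
    hinj.leftInvOn_invFunOn ha).1

theorem differentiableOn_invFunOn {f : ℂ → ℂ} {U : Set ℂ} (hU : IsOpen U)
    (hf : DifferentiableOn ℂ f U) (hinj : InjOn f U) :
    DifferentiableOn ℂ (Function.invFunOn f U) (f '' U) := by
  rintro _ ⟨a, ha, rfl⟩
  exact (deriv_ne_zero_and_differentiableAt_of_injOn hU hf hinj
    hinj.leftInvOn_invFunOn ha).2.differentiableWithinAt

theorem dslope_ne_zero_of_injOn {f : ℂ → ℂ} {U : Set ℂ} (hU : IsOpen U)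
    (hf : DifferentiableOn ℂ f U) (hinj : InjOn f U) {a z : ℂ} (ha : a ∈ U) (hz : z ∈ U) :
    dslope f a z ≠ 0 := by
  rcases eq_or_ne z a with rfl | hne
  · rw [dslope_same]
    exact deriv_ne_zero_of_injOn hU hf hinj ha
  · rw [dslope_of_ne _ hne, slope_def_field]
    exact div_ne_zero (sub_ne_zero.2 fun h => hne (hinj hz ha h)) (sub_ne_zero.2 hne)

/-! ### The domain bounded by the image of a circle -/

/-- The annulus is the image under `exp` of a vertical strip, which is convex. -/
theorem isPreconnected_setOf_norm_mem {I : Set ℝ} (hI : OrdConnected I) (hpos : ∀ t ∈ I, 0 < t) :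
    IsPreconnected {w : ℂ | ‖w‖ ∈ I} := by
  have hJ : OrdConnected (Real.exp ⁻¹' I) := hI.preimage_mono Real.exp_monotone
  have hc : Convex ℝ {s : ℂ | s.re ∈ Real.exp ⁻¹' I} :=
    hJ.convex.linear_preimage Complex.reLm
  have himg : {w : ℂ | ‖w‖ ∈ I} = Complex.exp '' {s : ℂ | s.re ∈ Real.exp ⁻¹' I} := by
    ext w
    constructor
    · intro hw
      have hw0 : w ≠ 0 := norm_pos_iff.1 (hpos _ hw)
      refine ⟨Complex.log w, ?_, Complex.exp_log hw0⟩
      rw [mem_ofPred_eq, mem_preimage, ← Complex.norm_exp, Complex.exp_log hw0]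
      exact hw
    · rintro ⟨s, hs, rfl⟩
      rw [mem_ofPred_eq, Complex.norm_exp]
      exact hs
  rw [himg]
  exact hc.isPreconnected.image _ Complex.continuous_exp.continuousOn

/-- The complement of the image of `{w | ρ ≤ ‖w‖}`. -/
def innerDomain (φ : ℂ → ℂ) (ρ : ℝ) : Set ℂ := (φ '' {w | ρ ≤ ‖w‖})ᶜ

/-- `φ` is injective and holomorphic near `{w | r ≤ ‖w‖} ∪ {∞}` and maps `∞` to `∞`. -/
structure IsExteriorMap (φ : ℂ → ℂ) (Ω : Set ℂ) (r : ℝ) : Prop where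
  pos : 0 < r
  isOpen : IsOpen Ω
  subset : ∀ w : ℂ, r ≤ ‖w‖ → w ∈ Ω
  holomorphic : DifferentiableOn ℂ φ Ω
  injOn : InjOn φ Ω
  tendsto_infty : Tendsto φ (cocompact ℂ) (cocompact ℂ)

namespace IsExteriorMap

variable {φ : ℂ → ℂ} {Ω : Set ℂ} {r ρ : ℝ}

theorem mono (h : IsExteriorMap φ Ω r) (hr : r ≤ ρ) : IsExteriorMap φ Ω ρ where
  pos := h.pos.trans_le hr
  isOpen := h.isOpen
  subset := fun w hw => h.subset w (hr.trans hw)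
  holomorphic := h.holomorphic
  injOn := h.injOn
  tendsto_infty := h.tendsto_infty

/-- Compactness of the circle leaves a collar inside it, on which `φ` is still defined and
injective. This turns the boundary circle into an interior one for the later lemmas. -/
theorem exists_lt (h : IsExteriorMap φ Ω r) : ∃ s < r, IsExteriorMap φ Ω s := by
  obtain ⟨δ, hδ, hsub⟩ := (isCompact_sphere (0 : ℂ) r).exists_cthickening_subset_open h.isOpen
    (fun w hw => h.subset w (by rw [mem_sphere_zero_iff_norm.1 hw]))
  refine ⟨max (r / 2) (r - δ), max_lt (by linarith [h.pos]) (by linarith), ?_⟩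
  have hpos : 0 < max (r / 2) (r - δ) := lt_max_of_lt_left (by linarith [h.pos])
  refine ⟨hpos, h.isOpen, fun w hw => ?_, h.holomorphic, h.injOn, h.tendsto_infty⟩
  rcases le_or_gt r ‖w‖ with hrw | hrw
  · exact h.subset w hrw
  have hw0 : 0 < ‖w‖ := hpos.trans_le hw
  have hw0' : (‖w‖ : ℂ) ≠ 0 := by exact_mod_cast hw0.ne'
  refine hsub (mem_cthickening_of_dist_le w ((r / ‖w‖ : ℝ) * w) δ _ ?_ ?_)
  · rw [mem_sphere_zero_iff_norm, norm_mul, Complex.norm_real,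
      Real.norm_of_nonneg (div_nonneg h.pos.le hw0.le), div_mul_cancel₀ _ hw0.ne']
  · have h1 : w - (r / ‖w‖ : ℝ) * w = ((1 - r / ‖w‖ : ℝ) : ℂ) * w := by push_cast; ring
    rw [dist_eq_norm, h1, norm_mul, Complex.norm_real, Real.norm_eq_abs,
      abs_of_nonpos (by rw [sub_nonpos, one_le_div hw0]; exact hrw.le), neg_sub, sub_mul,
      div_mul_cancel₀ _ hw0.ne']
    linarith [(le_max_right (r / 2) (r - δ)).trans hw]

/-- Since `φ` tends to `∞` at `∞`, parameters of a convergent sequence of values are eventually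
bounded, so a subsequence of them converges. -/
theorem isClosed_image (h : IsExteriorMap φ Ω r) : IsClosed (φ '' {w | r ≤ ‖w‖}) := by
  rw [← isSeqClosed_iff_isClosed]
  intro u z hu hz
  choose w hw hwu using hu
  have hbdd : ∃ M, ∀ᶠ n in atTop, ‖w n‖ ≤ M := by
    have hzc : ∀ᶠ y in cocompact ℂ, y ∉ closedBall z 1 :=
      (isCompact_closedBall z 1).compl_mem_cocompact
    obtain ⟨K, hK, hKs⟩ := mem_cocompact.1 (h.tendsto_infty.eventually hzc)
    obtain ⟨M, hM⟩ := hK.isBounded.subset_closedBall 0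
    refine ⟨M, ?_⟩
    filter_upwards [hz.eventually (closedBall_mem_nhds z one_pos)] with n hn
    by_contra hcon
    have : w n ∈ Kᶜ := fun hmem => hcon (mem_closedBall_zero_iff.1 (hM hmem))
    exact hKs this (by rw [hwu]; exact hn)
  obtain ⟨M, hM⟩ := hbdd
  have hK : IsCompact (closedBall (0 : ℂ) M ∩ {w | r ≤ ‖w‖}) :=
    (isCompact_closedBall 0 M).inter_right (isClosed_le continuous_const continuous_norm)
  obtain ⟨a, ha, ψ, hψ, hlim⟩ := hK.tendsto_subseq' (x := w)
    (hM.mono fun n hn => ⟨mem_closedBall_zero_iff.2 hn, hw n⟩).frequently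
  refine ⟨a, ha.2, tendsto_nhds_unique ?_ (hz.comp hψ.tendsto_atTop)⟩
  have haΩ : a ∈ Ω := h.subset a ha.2
  have hc := (h.holomorphic.differentiableAt (h.isOpen.mem_nhds haΩ)).continuousAt
  refine (hc.tendsto.comp hlim).congr fun n => ?_
  simp [hwu]

theorem isOpen_innerDomain (h : IsExteriorMap φ Ω r) : IsOpen (innerDomain φ r) :=
  h.isClosed_image.isOpen_compl

theorem isOpen_image (h : IsExteriorMap φ Ω r) : IsOpen (φ '' {w | r < ‖w‖}) :=
  isOpen_image_of_injOn h.isOpen h.holomorphic h.injOn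
    (isOpen_lt continuous_const continuous_norm) fun w hw => h.subset w (le_of_lt hw)

theorem isPreconnected_image (h : IsExteriorMap φ Ω r) : IsPreconnected (φ '' {w | r < ‖w‖}) := by
  refine (isPreconnected_setOf_norm_mem (I := Ioi r) ordConnected_Ioi
    fun t ht => h.pos.trans ht).image _ ?_
  exact h.holomorphic.continuousOn.mono fun w hw => h.subset w (le_of_lt hw)

theorem compl_image_sphere (h : IsExteriorMap φ Ω r) :
    (φ '' sphere 0 r)ᶜ = innerDomain φ r ∪ φ '' {w | r < ‖w‖} := by
  ext z
  constructor
  · intro hz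
    by_cases hzi : z ∈ φ '' {w | r ≤ ‖w‖}
    · obtain ⟨w, hw, rfl⟩ := hzi
      refine Or.inr ⟨w, show r < ‖w‖ from lt_of_le_of_ne hw fun heq => hz ⟨w, ?_, rfl⟩, rfl⟩
      exact mem_sphere_zero_iff_norm.2 heq.symm
    · exact Or.inl hzi
  · rintro (hz | ⟨w, hw, rfl⟩) ⟨v, hv, hvz⟩
    · exact hz ⟨v, (mem_sphere_zero_iff_norm.1 hv).ge, hvz⟩
    · rw [mem_sphere_zero_iff_norm] at hv
      have : v = w := h.injOn (h.subset v hv.ge) (h.subset w (le_of_lt hw)) hvz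
      rw [this] at hv
      exact (ne_of_gt hw) hv

theorem disjoint_innerDomain_image : Disjoint (innerDomain φ r) (φ '' {w | r < ‖w‖}) := by
  rw [Set.disjoint_left]
  rintro _ hz ⟨w, hw, rfl⟩
  exact hz ⟨w, show r ≤ ‖w‖ from le_of_lt hw, rfl⟩

/-- Outside a large disk there is no point of the curve, and `{M < ‖z‖}` is connected. It therefore
lies on one side, which is the outer one because `φ w` is large for large `w`. -/
theorem exists_subset_image (h : IsExteriorMap φ Ω r) :
    ∃ M > 0, {z : ℂ | M < ‖z‖} ⊆ φ '' {w | r < ‖w‖} := by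
  have hγ : IsCompact (φ '' sphere 0 r) := (isCompact_sphere (0 : ℂ) r).image_of_continuousOn
    (h.holomorphic.continuousOn.mono fun w hw => h.subset w (mem_sphere_zero_iff_norm.1 hw).ge)
  obtain ⟨M, hMp, hM⟩ := hγ.isBounded.subset_closedBall_lt 0 0
  refine ⟨M, hMp, ?_⟩
  have hpre := isPreconnected_setOf_norm_mem (I := Ioi M) ordConnected_Ioi
    fun t ht => lt_trans hMp ht
  refine hpre.subset_right_of_subset_union h.isOpen_innerDomain h.isOpen_image
    disjoint_innerDomain_image ?_ ?_
  · rw [← h.compl_image_sphere]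
    intro z hz hzγ
    exact absurd (mem_closedBall_zero_iff.1 (hM hzγ)) (not_le.2 hz)
  · have h1 : ∀ᶠ w in cocompact ℂ, M < ‖φ w‖ :=
      (tendsto_norm_cocompact_atTop.comp h.tendsto_infty).eventually_gt_atTop M
    have h2 : ∀ᶠ w : ℂ in cocompact ℂ, r < ‖w‖ :=
      (tendsto_norm_cocompact_atTop (E := ℂ)).eventually_gt_atTop r
    obtain ⟨w, hw1, hw2⟩ := (h1.and h2).exists
    exact ⟨φ w, hw1, w, hw2, rfl⟩

theorem isBounded_innerDomain (h : IsExteriorMap φ Ω r) :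
    Bornology.IsBounded (innerDomain φ r) := by
  obtain ⟨M, -, hM⟩ := h.exists_subset_image
  refine isBounded_closedBall (x := (0 : ℂ)) (r := M) |>.subset fun z hz => ?_
  rw [mem_closedBall_zero_iff]
  by_contra hcon
  exact Set.disjoint_left.1 disjoint_innerDomain_image hz (hM (not_le.1 hcon))

/-- The complement of the curve is a disjoint union of two open sets: the connected unbounded outer
image and the bounded `innerDomain`. Connectedness of the inner set is not needed here. -/
theorem curveInterior_image_sphere (h : IsExteriorMap φ Ω r) :
    curveInterior (φ '' sphere 0 r) = innerDomain φ r := by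
  ext z
  constructor
  · rintro ⟨hz, hb⟩
    rcases (h.compl_image_sphere ▸ hz : z ∈ innerDomain φ r ∪ φ '' {w | r < ‖w‖}) with hz' | hz'
    · exact hz'
    exfalso
    have hsub := h.isPreconnected_image.subset_connectedComponentIn hz'
      (F := (φ '' sphere 0 r)ᶜ) (by rw [h.compl_image_sphere]; exact subset_union_right)
    obtain ⟨M, hMp, hM⟩ := h.exists_subset_image
    obtain ⟨N, hNp, hN⟩ := (hb.subset (hM.trans hsub)).subset_closedBall_lt 0 0
    have h1 : ((M + N : ℝ) : ℂ) ∈ {z : ℂ | M < ‖z‖} := by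
      rw [mem_ofPred_eq, Complex.norm_real, Real.norm_of_nonneg (by linarith)]
      linarith
    have h2 := mem_closedBall_zero_iff.1 (hN h1)
    rw [Complex.norm_real, Real.norm_of_nonneg (by linarith)] at h2
    linarith
  · intro hz
    have hzγ : z ∈ (φ '' sphere 0 r)ᶜ := by rw [h.compl_image_sphere]; exact Or.inl hz
    refine ⟨hzγ, h.isBounded_innerDomain.subset ?_⟩
    refine isPreconnected_connectedComponentIn.subset_left_of_subset_union h.isOpen_innerDomain
      h.isOpen_image disjoint_innerDomain_image ?_ ⟨z, mem_connectedComponentIn hzγ, hz⟩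
    rw [← h.compl_image_sphere]
    exact connectedComponentIn_subset _ _

theorem innerDomain_mono {s : ℝ} (hs : r ≤ s) : innerDomain φ r ⊆ innerDomain φ s :=
  compl_subset_compl.2 (image_mono fun _ hw => hs.trans hw)

theorem apply_mem_innerDomain (h : IsExteriorMap φ Ω r) {w : ℂ} (hw : r ≤ ‖w‖) (hwρ : ‖w‖ < ρ) :
    φ w ∈ innerDomain φ ρ := by
  rintro ⟨v, hv, hvw⟩
  have : v = w := h.injOn (h.subset v ((hw.trans hwρ.le).trans hv)) (h.subset w hw) hvw
  rw [this] at hv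
  exact (not_le.2 hwρ) hv

/-- Every component meets the connected collar `φ (r < |w| < ρ)`. One that did not would have its
closure outside the open set `φ (r < |w|)`, hence inside the domain; it would be clopen in `ℂ` and
bounded, which is absurd. -/
theorem isPreconnected_innerDomain (h : IsExteriorMap φ Ω r) (hρ : r < ρ) :
    IsPreconnected (innerDomain φ ρ) := by
  have hopen := (h.mono hρ.le).isOpen_innerDomain
  set V := φ '' {w | ‖w‖ ∈ Ioo r ρ} with hV
  have hVpre : IsPreconnected V :=
    (isPreconnected_setOf_norm_mem (I := Ioo r ρ) ordConnected_Ioo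
      fun t ht => h.pos.trans ht.1).image _
      (h.holomorphic.continuousOn.mono fun w hw => h.subset w (le_of_lt hw.1))
  have hVsub : V ⊆ innerDomain φ ρ := by
    rintro _ ⟨w, hw, rfl⟩
    exact h.apply_mem_innerDomain hw.1.le hw.2
  have hmeet : ∀ z ∈ innerDomain φ ρ, (connectedComponentIn (innerDomain φ ρ) z ∩ V).Nonempty := by
    intro z hz
    by_contra hcon
    set C := connectedComponentIn (innerDomain φ ρ) z with hC
    have hCsub : C ⊆ innerDomain φ ρ := connectedComponentIn_subset _ _
    have hzC : z ∈ C := mem_connectedComponentIn hz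
    have hCc : C ⊆ (φ '' {w | r < ‖w‖})ᶜ := by
      rintro _ hx ⟨w, hw, rfl⟩
      rcases lt_or_ge ‖w‖ ρ with hwρ | hwρ
      · exact hcon ⟨_, hx, w, ⟨hw, hwρ⟩, rfl⟩
      · exact hCsub hx ⟨w, hwρ, rfl⟩
    have hclos : closure C ⊆ (φ '' {w | r < ‖w‖})ᶜ :=
      closure_minimal hCc h.isOpen_image.isClosed_compl
    have hclos' : closure C ⊆ innerDomain φ ρ :=
      hclos.trans (compl_subset_compl.2 (image_mono fun w hw => lt_of_lt_of_le hρ hw))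
    have hCclosed : closure C ⊆ C :=
      isPreconnected_connectedComponentIn.closure.subset_connectedComponentIn
        (subset_closure hzC) hclos'
    have hclopen : IsClopen C :=
      ⟨isClosed_of_closure_subset hCclosed, hopen.connectedComponentIn⟩
    have huniv : C = univ := hclopen.eq_univ ⟨z, hzC⟩
    have hb := (h.mono hρ.le).isBounded_innerDomain.subset hCsub
    rw [huniv] at hb
    exact NormedSpace.unbounded_univ ℂ ℂ hb
  have hx : ((((r + ρ) / 2 : ℝ) : ℂ)) ∈ {w : ℂ | ‖w‖ ∈ Ioo r ρ} := by
    rw [mem_ofPred_eq, Complex.norm_real, Real.norm_of_nonneg (by linarith [h.pos])]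
    constructor <;> linarith
  refine isPreconnected_of_forall (φ ((r + ρ) / 2 : ℝ)) fun z hz => ?_
  obtain ⟨y, hyC, hyV⟩ := hmeet z hz
  exact ⟨connectedComponentIn (innerDomain φ ρ) z ∪ V,
    union_subset (connectedComponentIn_subset _ _) hVsub, Or.inr ⟨_, hx, rfl⟩,
    Or.inl (mem_connectedComponentIn hz),
    isPreconnected_connectedComponentIn.union y hyC hyV hVpre⟩

end IsExteriorMap

/-! ### Holomorphic dependence of integrals on a parameter -/

theorem hasDerivAt_setIntegral_of_continuousOn {X : Type*} [TopologicalSpace X] [T2Space X]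
    [SecondCountableTopology X] [MeasurableSpace X] [BorelSpace X] {μ : Measure X}
    [IsFiniteMeasureOnCompacts μ] {K : Set X} (hK : IsCompact K) {U : Set ℂ} (hU : IsOpen U)
    {F F' : ℂ → X → ℂ} (hF : ∀ z ∈ U, ContinuousOn (F z) K)
    (hF' : ContinuousOn (fun q : ℂ × X => F' q.1 q.2) (U ×ˢ K))
    (hderiv : ∀ x ∈ K, ∀ z ∈ U, HasDerivAt (fun y => F y x) (F' z x) z) {z : ℂ} (hz : z ∈ U) :
    HasDerivAt (fun y => ∫ x in K, F y x ∂μ) (∫ x in K, F' z x ∂μ) z := by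
  obtain ⟨ε, hε, hεU⟩ := nhds_basis_closedBall.mem_iff.1 (hU.mem_nhds hz)
  obtain ⟨C, hC⟩ := ((isCompact_closedBall z ε).prod hK).exists_bound_of_continuousOn
    (hF'.mono (prod_mono hεU subset_rfl))
  have hKm := hK.measurableSet
  refine (hasDerivAt_integral_of_dominated_loc_of_deriv_le (bound := fun _ => C)
    (closedBall_mem_nhds z hε) ?_ ?_ ?_ ?_ ?_ ?_).2
  · filter_upwards [hU.mem_nhds hz] with y hy
    exact (hF y hy).aestronglyMeasurable hKm
  · exact (hF z hz).integrableOn_compact hK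
  · refine ContinuousOn.aestronglyMeasurable (hF'.comp (f := fun x => (z, x)) (by fun_prop) ?_) hKm
    exact fun x hx => ⟨hz, hx⟩
  · filter_upwards [ae_restrict_mem hKm] with x hx y hy
    exact hC (y, x) ⟨hy, hx⟩
  · exact integrableOn_const hK.measure_lt_top.ne
  · filter_upwards [ae_restrict_mem hKm] with x hx y hy
    exact hderiv x hx y (hεU hy)

theorem circleIntegral_eq_setIntegral (f : ℂ → ℂ) (ρ : ℝ) :
    (∮ w in C(0, ρ), f w) =
      ∫ θ in Icc 0 (2 * Real.pi), deriv (circleMap 0 ρ) θ * f (circleMap 0 ρ θ) := by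
  rw [circleIntegral, intervalIntegral.integral_of_le (by positivity),
    ← integral_Icc_eq_integral_Ioc]
  rfl

theorem continuous_deriv_circleMap (ρ : ℝ) : Continuous (deriv (circleMap 0 ρ)) := by
  have : deriv (circleMap 0 ρ) = fun θ => circleMap 0 ρ θ * Complex.I := by
    ext θ; simp [deriv_circleMap]
  rw [this]
  exact (continuous_circleMap 0 ρ).mul continuous_const

theorem differentiableAt_circleIntegral_div_sub {a b : ℂ → ℂ} {ρ : ℝ} (hρ : 0 ≤ ρ)
    (ha : ContinuousOn a (sphere 0 ρ)) (hb : ContinuousOn b (sphere 0 ρ)) {z : ℂ}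
    (hz : z ∉ b '' sphere 0 ρ) :
    DifferentiableAt ℂ (fun y => ∮ w in C(0, ρ), a w / (b w - y)) z := by
  simp only [circleIntegral_eq_setIntegral]
  have hU : IsOpen (b '' sphere 0 ρ)ᶜ :=
    ((isCompact_sphere (0 : ℂ) ρ).image_of_continuousOn hb).isClosed.isOpen_compl
  have hm : ∀ θ, circleMap 0 ρ θ ∈ sphere (0 : ℂ) ρ := circleMap_mem_sphere 0 hρ
  have ha' : Continuous fun θ => a (circleMap 0 ρ θ) :=
    ha.comp_continuous (continuous_circleMap 0 ρ) hm
  have hb' : Continuous fun θ => b (circleMap 0 ρ θ) :=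
    hb.comp_continuous (continuous_circleMap 0 ρ) hm
  have hd := continuous_deriv_circleMap ρ
  have hne : ∀ y ∈ (b '' sphere 0 ρ)ᶜ, ∀ θ, b (circleMap 0 ρ θ) - y ≠ 0 := fun y hy θ h =>
    hy ⟨_, hm θ, sub_eq_zero.1 h⟩
  refine (hasDerivAt_setIntegral_of_continuousOn (μ := volume) isCompact_Icc hU
    (F := fun y θ => deriv (circleMap 0 ρ) θ * (a (circleMap 0 ρ θ) / (b (circleMap 0 ρ θ) - y)))
    (F' := fun y θ =>
      deriv (circleMap 0 ρ) θ * (a (circleMap 0 ρ θ) / (b (circleMap 0 ρ θ) - y) ^ 2))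
    (fun y hy => ?_) ?_ (fun θ _ y hy => ?_) hz).differentiableAt
  · exact (hd.mul (ha'.div (hb'.sub continuous_const) (hne y hy))).continuousOn
  · refine ContinuousOn.mul (hd.comp continuous_snd).continuousOn (ContinuousOn.div
      (ha'.comp continuous_snd).continuousOn
      (((hb'.comp continuous_snd).sub continuous_fst).pow 2).continuousOn ?_)
    rintro ⟨y, θ⟩ ⟨hy, -⟩
    exact pow_ne_zero 2 (hne y hy θ)
  · have h1 : HasDerivAt (fun y => b (circleMap 0 ρ θ) - y) (-1) y := by
      simpa using (hasDerivAt_id y).const_sub (b (circleMap 0 ρ θ))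
    have h2 := ((hasDerivAt_const y (a (circleMap 0 ρ θ))).fun_div h1 (hne y hy θ)).const_mul
      (deriv (circleMap 0 ρ) θ)
    convert! h2 using 1
    ring

theorem tendsto_circleIntegral_div_sub {a b : ℂ → ℂ} {ρ : ℝ} (hρ : 0 ≤ ρ)
    (ha : ContinuousOn a (sphere 0 ρ)) (hb : ContinuousOn b (sphere 0 ρ)) :
    Tendsto (fun y => ∮ w in C(0, ρ), a w / (b w - y)) (cocompact ℂ) (𝓝 0) := by
  obtain ⟨A, hA⟩ := (isCompact_sphere (0 : ℂ) ρ).exists_bound_of_continuousOn ha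
  obtain ⟨B, hB⟩ := (isCompact_sphere (0 : ℂ) ρ).exists_bound_of_continuousOn hb
  have hnorm : Tendsto (fun y : ℂ => ‖y‖ - B) (cocompact ℂ) atTop :=
    tendsto_atTop_add_const_right _ _ tendsto_norm_cocompact_atTop
  have hlim : Tendsto (fun y : ℂ => 2 * Real.pi * ρ * (|A| / (‖y‖ - B))) (cocompact ℂ) (𝓝 0) := by
    have := (hnorm.const_div_atTop |A|).const_mul (2 * Real.pi * ρ)
    simpa using this
  refine squeeze_zero_norm' ?_ hlim
  filter_upwards [hnorm.eventually_gt_atTop 0] with y hy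
  refine circleIntegral.norm_integral_le_of_norm_le_const hρ fun w hw => ?_
  rw [norm_div]
  have h1 := norm_sub_norm_le y (b w)
  rw [norm_sub_rev] at h1
  exact div_le_div₀ (abs_nonneg A) ((hA w hw).trans (le_abs_self A)) hy
    (by linarith [hB w hw])

/-! ### Cauchy's formula for the domain inside the image of a circle -/

namespace IsExteriorMap

variable {φ g : ℂ → ℂ} {Ω : Set ℂ} {r s σ ρ : ℝ}

theorem isOpen_annulus (r ρ : ℝ) : IsOpen {w : ℂ | r < ‖w‖ ∧ ‖w‖ < ρ} :=
  (isOpen_lt continuous_const continuous_norm).inter (isOpen_lt continuous_norm continuous_const)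

theorem differentiableOn_comp (h : IsExteriorMap φ Ω r)
    (hg : DifferentiableOn ℂ g (innerDomain φ ρ)) :
    DifferentiableOn ℂ (fun w => g (φ w)) {w | r < ‖w‖ ∧ ‖w‖ < ρ} :=
  hg.comp (h.holomorphic.mono fun w hw => h.subset w hw.1.le)
    fun _ hw => h.apply_mem_innerDomain hw.1.le hw.2

theorem differentiableOn_pullback (h : IsExteriorMap φ Ω r)
    (hg : DifferentiableOn ℂ g (innerDomain φ ρ)) :
    DifferentiableOn ℂ (fun w => g (φ w) * deriv φ w) {w | r < ‖w‖ ∧ ‖w‖ < ρ} :=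
  (h.differentiableOn_comp hg).mul
    ((h.holomorphic.deriv h.isOpen).mono fun w hw => h.subset w hw.1.le)

theorem sphere_subset_annulus (hr : r < σ) (hρ : σ < ρ) :
    sphere (0 : ℂ) σ ⊆ {w | r < ‖w‖ ∧ ‖w‖ < ρ} := fun w hw => by
  rw [mem_ofPred_eq, mem_sphere_zero_iff_norm.1 hw]
  exact ⟨hr, hρ⟩

theorem continuousOn_sphere (h : IsExteriorMap φ Ω r) (hr : r ≤ σ) :
    ContinuousOn φ (sphere 0 σ) :=
  h.holomorphic.continuousOn.mono fun w hw => h.subset w (by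
    rwa [mem_sphere_zero_iff_norm.1 hw])

theorem circleIntegral_sub_circleIntegral (h : IsExteriorMap φ Ω r)
    (hg : DifferentiableOn ℂ g (innerDomain φ ρ)) {w₀ : ℂ} (hrs : r < s) (hs : s < ‖w₀‖)
    (hσ : ‖w₀‖ < σ) (hσρ : σ < ρ) :
    (∮ w in C(0, σ), g (φ w) * deriv φ w / (φ w - φ w₀)) -
      (∮ w in C(0, s), g (φ w) * deriv φ w / (φ w - φ w₀)) =
      2 * Real.pi * Complex.I * g (φ w₀) := by
  set N : Set ℂ := {w | r < ‖w‖ ∧ ‖w‖ < ρ} with hN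
  have hNo : IsOpen N := isOpen_annulus r ρ
  have hw₀ : w₀ ∈ N := ⟨hrs.trans hs, hσ.trans hσρ⟩
  have hNΩ : N ⊆ Ω := fun w hw => h.subset w hw.1.le
  have hslope : DifferentiableOn ℂ (dslope φ w₀) N :=
    (Complex.differentiableOn_dslope (hNo.mem_nhds hw₀)).2 (h.holomorphic.mono hNΩ)
  have hslope0 : ∀ w ∈ N, dslope φ w₀ w ≠ 0 := fun w hw =>
    dslope_ne_zero_of_injOn h.isOpen h.holomorphic h.injOn (hNΩ hw₀) (hNΩ hw)
  -- The integrand is `M w / (w - w₀)` with `M` holomorphic on the annulus and `M w₀ = g (φ w₀)`. It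
  -- splits into `dslope M w₀`, whose integrals over the two circles agree, and `M w₀ / (w - w₀)`,
  -- whose integrals differ by the residue.
  set M : ℂ → ℂ := fun w => g (φ w) * deriv φ w / dslope φ w₀ w with hM
  have hMd : DifferentiableOn ℂ M N := (h.differentiableOn_pullback hg).div hslope hslope0
  have hMw : M w₀ = g (φ w₀) := by
    have h0 := hslope0 w₀ hw₀
    simp only [hM]
    rw [dslope_same] at h0 ⊢
    exact mul_div_cancel_right₀ _ h0
  have hdM : DifferentiableOn ℂ (dslope M w₀) N :=
    (Complex.differentiableOn_dslope (hNo.mem_nhds hw₀)).2 hMd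
  have hs0 : 0 < s := h.pos.trans hrs
  have hcircle : ∀ t, r < t → t < ρ → t ≠ ‖w₀‖ →
      (∮ w in C(0, t), g (φ w) * deriv φ w / (φ w - φ w₀)) =
        (∮ w in C(0, t), dslope M w₀ w) + g (φ w₀) * ∮ w in C(0, t), (w - w₀)⁻¹ := by
    intro t hrt htρ htw
    have ht0 : 0 ≤ t := (h.pos.trans hrt).le
    have hne : ∀ w ∈ sphere (0 : ℂ) t, w ≠ w₀ := by
      rintro w hw rfl
      exact htw (mem_sphere_zero_iff_norm.1 hw).symm
    have hsub := sphere_subset_annulus hrt htρ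
    have hinv : ContinuousOn (fun w => (w - w₀)⁻¹) (sphere (0 : ℂ) t) :=
      ContinuousOn.inv₀ (by fun_prop) fun w hw => sub_ne_zero.2 (hne w hw)
    rw [← circleIntegral.integral_const_mul, ← circleIntegral.integral_add
      ((hdM.continuousOn.mono hsub).circleIntegrable ht0)
      (ContinuousOn.circleIntegrable (f := fun w => g (φ w₀) * (w - w₀)⁻¹) ht0
        (continuousOn_const.mul hinv))]
    refine circleIntegral.integral_congr ht0 fun w hw => ?_
    have hwne := sub_ne_zero.2 (hne w hw)
    have hφne : φ w - φ w₀ ≠ 0 := sub_ne_zero.2 fun heq =>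
      hne w hw (h.injOn (hNΩ (hsub hw)) (hNΩ hw₀) heq)
    rw [dslope_of_ne _ (hne w hw), slope_def_field, hMw]
    simp only [hM]
    rw [dslope_of_ne _ (hne w hw), slope_def_field]
    field_simp
    ring
  rw [hcircle σ ((hrs.trans hs).trans hσ) hσρ hσ.ne',
    hcircle s hrs ((hs.trans hσ).trans hσρ) hs.ne]
  have h1 : (∮ w in C(0, σ), dslope M w₀ w) = ∮ w in C(0, s), dslope M w₀ w := by
    refine Complex.circleIntegral_eq_of_differentiable_on_annulus_off_countable hs0
      (hs.trans hσ).le countable_empty (hdM.continuousOn.mono ?_) ?_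
    · rintro w ⟨hw1, hw2⟩
      rw [mem_closedBall_zero_iff] at hw1
      rw [mem_ball_zero_iff, not_lt] at hw2
      exact ⟨hrs.trans_le hw2, hw1.trans_lt hσρ⟩
    · rintro w ⟨⟨hw1, hw2⟩, -⟩
      rw [mem_ball_zero_iff] at hw1
      rw [mem_closedBall_zero_iff, not_le] at hw2
      exact hdM.differentiableAt (hNo.mem_nhds ⟨hrs.trans hw2, hw1.trans hσρ⟩)
  have h2 : (∮ w in C(0, σ), (w - w₀)⁻¹) = 2 * Real.pi * Complex.I :=
    circleIntegral.integral_sub_inv_of_mem_ball (mem_ball_zero_iff.2 hσ)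
  have h3 : (∮ w in C(0, s), (w - w₀)⁻¹) = 0 := by
    have hne : ∀ w ∈ closedBall (0 : ℂ) s, w - w₀ ≠ 0 := fun w hw heq => by
      rw [sub_eq_zero.1 heq, mem_closedBall_zero_iff] at hw
      exact absurd hw (not_le.2 hs)
    refine Complex.circleIntegral_eq_zero_of_differentiable_on_off_countable hs0.le
      countable_empty (ContinuousOn.inv₀ (by fun_prop) hne) fun w hw => ?_
    exact DifferentiableAt.fun_inv (by fun_prop) (hne w (ball_subset_closedBall hw.1))
  rw [h1, h2, h3]
  ring

/-- **Cauchy's formula** for the domain inside the image of a circle. -/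
theorem circleIntegral_eq (h : IsExteriorMap φ Ω r)
    (hg : DifferentiableOn ℂ g (innerDomain φ ρ)) (hrσ : r < σ) (hσρ : σ < ρ) {z : ℂ}
    (hz : z ∈ innerDomain φ σ) :
    (∮ w in C(0, σ), g (φ w) * deriv φ w / (φ w - z)) = 2 * Real.pi * Complex.I * g z := by
  classical
  obtain ⟨s, hrs, hsσ⟩ := exists_between hrσ
  have hsρ := hsσ.trans hσρ
  have hpull := (h.differentiableOn_pullback hg).continuousOn
  have hdiff : ∀ t, r < t → t < ρ → ∀ z ∉ φ '' sphere 0 t,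
      DifferentiableAt ℂ (fun y => ∮ w in C(0, t), g (φ w) * deriv φ w / (φ w - y)) z :=
    fun t hrt htρ z hz => differentiableAt_circleIntegral_div_sub (h.pos.trans hrt).le
      (hpull.mono (sphere_subset_annulus hrt htρ)) (h.continuousOn_sphere hrt.le) hz
  have hDo : IsOpen (innerDomain φ σ) := (h.mono hrσ.le).isOpen_innerDomain
  -- The residue computation shows that the two formulas agree on the collar `φ (s < |w| < σ)`, so
  -- `H` is entire. It tends to `0` at `∞`, so it vanishes by Liouville.
  set H : ℂ → ℂ := fun z => if z ∈ innerDomain φ σ then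
      (∮ w in C(0, σ), g (φ w) * deriv φ w / (φ w - z)) - 2 * Real.pi * Complex.I * g z
    else ∮ w in C(0, s), g (φ w) * deriv φ w / (φ w - z) with hH
  have hHd : Differentiable ℂ H := by
    intro z
    by_cases hz : z ∈ innerDomain φ σ
    · have h1 : DifferentiableAt ℂ (fun z => (∮ w in C(0, σ), g (φ w) * deriv φ w / (φ w - z)) -
          2 * Real.pi * Complex.I * g z) z := by
        refine (hdiff σ hrσ hσρ z ?_).sub (((hg.differentiableAt ?_)).const_mul _)
        · rintro ⟨w, hw, rfl⟩
          exact hz ⟨w, (mem_sphere_zero_iff_norm.1 hw).ge, rfl⟩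
        · exact mem_of_superset (hDo.mem_nhds hz) (innerDomain_mono hσρ.le)
      refine h1.congr_of_eventuallyEq ?_
      filter_upwards [hDo.mem_nhds hz] with y hy
      simp only [hH, if_pos hy]
    · obtain ⟨w₀, hw₀, rfl⟩ : z ∈ φ '' {w | σ ≤ ‖w‖} := not_not.1 hz
      have hw₀' : s < ‖w₀‖ := hsσ.trans_le hw₀
      have h1 : DifferentiableAt ℂ
          (fun z => ∮ w in C(0, s), g (φ w) * deriv φ w / (φ w - z)) (φ w₀) := by
        refine hdiff s hrs hsρ _ ?_
        rintro ⟨v, hv, hvw⟩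
        rw [mem_sphere_zero_iff_norm] at hv
        have := h.injOn (h.subset v (by rw [hv]; exact hrs.le))
          (h.subset w₀ (hrs.trans hw₀').le) hvw
        rw [← this, hv] at hw₀'
        exact lt_irrefl _ hw₀'
      refine h1.congr_of_eventuallyEq ?_
      filter_upwards [(h.mono hrs.le).isOpen_image.mem_nhds ⟨w₀, hw₀', rfl⟩]
      rintro _ ⟨w, hw, rfl⟩
      by_cases hwD : φ w ∈ innerDomain φ σ
      · have hwσ : ‖w‖ < σ := not_le.1 fun hcon => hwD ⟨w, hcon, rfl⟩
        simp only [hH, if_pos hwD]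
        rw [← h.circleIntegral_sub_circleIntegral hg hrs hw hwσ hσρ]
        ring
      · simp only [hH, if_neg hwD]
  have hHlim : Tendsto H (cocompact ℂ) (𝓝 0) := by
    refine (tendsto_circleIntegral_div_sub (h.pos.trans hrs).le
      (hpull.mono (sphere_subset_annulus hrs hsρ)) (h.continuousOn_sphere hrs.le)).congr' ?_
    have hb := (h.mono hrσ.le).isBounded_innerDomain
    have : (innerDomain φ σ)ᶜ ∈ cocompact ℂ := by
      rw [← Metric.cobounded_eq_cocompact]
      exact Bornology.isBounded_def.1 hb
    filter_upwards [this] with y hy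
    simp only [hH, if_neg hy]
  have h0 := hHd.apply_eq_of_tendsto_cocompact z hHlim
  simp only [hH, if_pos hz] at h0
  exact sub_eq_zero.1 h0

/-- The poles `φ w`, `‖w‖ = σ`, can be moved to `φ (T * w)`. -/
theorem isExactOn_circleIntegral_sub (h : IsExteriorMap φ Ω r) (hrσ : r < σ) {a : ℂ → ℂ}
    (ha : ContinuousOn a (sphere 0 σ)) {T : ℝ} (hT : 1 ≤ T) :
    Complex.IsExactOn (fun z => (∮ w in C(0, σ), a w / (φ w - z)) -
      ∮ w in C(0, σ), a w / (φ (T * w) - z)) (innerDomain φ σ) := by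
  have hσ0 : 0 < σ := h.pos.trans hrσ
  have hm : ∀ θ, circleMap 0 σ θ ∈ sphere (0 : ℂ) σ := circleMap_mem_sphere 0 hσ0.le
  set c : ℝ → ℂ := circleMap 0 σ with hc
  have hcn : ∀ θ, ‖c θ‖ = σ := fun θ => mem_sphere_zero_iff_norm.1 (hm θ)
  have hcc : Continuous c := continuous_circleMap 0 σ
  have hdc : Continuous (deriv c) := continuous_deriv_circleMap σ
  have hac : Continuous fun θ => a (c θ) := ha.comp_continuous hcc hm
  have htn : ∀ θ, ∀ t : ℝ, 1 ≤ t → σ ≤ ‖(t : ℂ) * c θ‖ := by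
    intro θ t ht
    rw [norm_mul, hcn, Complex.norm_real, Real.norm_of_nonneg (by linarith)]
    nlinarith
  have htΩ : ∀ θ, ∀ t : ℝ, 1 ≤ t → (t : ℂ) * c θ ∈ Ω := fun θ t ht =>
    h.subset _ (hrσ.le.trans (htn θ t ht))
  have hne : ∀ z ∈ innerDomain φ σ, ∀ θ, ∀ t : ℝ, 1 ≤ t → φ (t * c θ) - z ≠ 0 :=
    fun z hz θ t ht h0 => hz ⟨_, htn θ t ht, sub_eq_zero.1 h0⟩
  set K : Set (ℝ × ℝ) := Icc 0 (2 * Real.pi) ×ˢ Icc 1 T with hK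
  have hKc : IsCompact K := isCompact_Icc.prod isCompact_Icc
  have hφc : ContinuousOn (fun q : ℝ × ℝ => φ (q.2 * c q.1)) K :=
    h.holomorphic.continuousOn.comp (Continuous.continuousOn (by fun_prop))
      fun q hq => htΩ q.1 q.2 hq.2.1
  have hdφc : ContinuousOn (fun q : ℝ × ℝ => deriv φ (q.2 * c q.1)) K :=
    (h.holomorphic.deriv h.isOpen).continuousOn.comp (Continuous.continuousOn (by fun_prop))
      fun q hq => htΩ q.1 q.2 hq.2.1
  set A : ℝ × ℝ → ℂ := fun q => deriv c q.1 * a (c q.1) * (deriv φ (q.2 * c q.1) * c q.1) with hA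
  have hAc : ContinuousOn A K :=
    ContinuousOn.mul ((hdc.mul hac).comp continuous_fst).continuousOn
      (hdφc.mul (Continuous.continuousOn (by fun_prop)))
  -- Differentiating in `z` squares the denominator, and the result is the `t`-derivative of `-(c' θ
  -- * a (c θ)) / (φ (t * c θ) - z)`. Fubini and integration over `t` from `1` to `T` leave the
  -- difference of the two circle integrals.
  refine ⟨fun z => ∫ q in K, A q / (φ (q.2 * c q.1) - z), fun z hz => ?_⟩
  have hder := hasDerivAt_setIntegral_of_continuousOn (μ := (volume : Measure (ℝ × ℝ))) hKc
    (h.mono hrσ.le).isOpen_innerDomain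
    (F := fun z q => A q / (φ (q.2 * c q.1) - z))
    (F' := fun z q => A q / (φ (q.2 * c q.1) - z) ^ 2)
    (fun z hz => hAc.div (hφc.sub continuousOn_const) fun q hq => hne z hz q.1 q.2 hq.2.1)
    (by
      refine ContinuousOn.div (hAc.comp (by fun_prop) fun q hq => hq.2)
        (((hφc.comp (f := fun q : ℂ × (ℝ × ℝ) => q.2) (by fun_prop)
          fun q hq => hq.2).sub (by fun_prop)).pow 2) ?_
      rintro ⟨z, q⟩ ⟨hz, hq⟩
      exact pow_ne_zero 2 (hne z hz q.1 q.2 hq.2.1))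
    (fun q hq z hz => by
      have h1 : HasDerivAt (fun y => φ (q.2 * c q.1) - y) (-1) z := by
        simpa using (hasDerivAt_id z).const_sub (φ (q.2 * c q.1))
      have h2 := (hasDerivAt_const z (A q)).fun_div h1 (hne z hz q.1 q.2 hq.2.1)
      convert! h2 using 1
      ring) hz
  have hval : (∫ q in K, A q / (φ (q.2 * c q.1) - z) ^ 2) =
      (∮ w in C(0, σ), a w / (φ w - z)) - ∮ w in C(0, σ), a w / (φ (T * w) - z) := by
    have hint : IntegrableOn (fun q => A q / (φ (q.2 * c q.1) - z) ^ 2) K :=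
      (hAc.div ((hφc.sub continuousOn_const).pow 2) fun q hq =>
        pow_ne_zero 2 (hne z hz q.1 q.2 hq.2.1)).integrableOn_compact hKc
    have hφ1 : Continuous fun θ => φ (c θ) :=
      h.holomorphic.continuousOn.comp_continuous hcc fun θ => by simpa using htΩ θ 1 le_rfl
    have hφT : Continuous fun θ => φ (T * c θ) :=
      h.holomorphic.continuousOn.comp_continuous (by fun_prop) fun θ => htΩ θ T hT
    have hne1 : ∀ θ, φ (c θ) - z ≠ 0 := fun θ => by simpa using hne z hz θ 1 le_rfl
    have hneT : ∀ θ, φ (T * c θ) - z ≠ 0 := fun θ => hne z hz θ T hT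
    rw [circleIntegral_eq_setIntegral, circleIntegral_eq_setIntegral, ← integral_sub]
    rotate_left
    · exact (hdc.mul (hac.div (hφ1.sub continuous_const) hne1)).continuousOn.integrableOn_compact
        isCompact_Icc
    · exact (hdc.mul (hac.div (hφT.sub continuous_const) hneT)).continuousOn.integrableOn_compact
        isCompact_Icc
    rw [hK, Measure.volume_eq_prod, setIntegral_prod _ (by rwa [← Measure.volume_eq_prod])]
    refine integral_congr_ae (Eventually.of_forall fun θ => ?_)
    simp only [hA]
    have hftc : (∫ t in (1 : ℝ)..T, deriv c θ * a (c θ) * (deriv φ (t * c θ) * c θ) /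
        (φ (t * c θ) - z) ^ 2) =
        -(deriv c θ * a (c θ)) / (φ (T * c θ) - z) -
          -(deriv c θ * a (c θ)) / (φ ((1 : ℝ) * c θ) - z) := by
      refine intervalIntegral.integral_eq_sub_of_hasDerivAt
        (f := fun t : ℝ => -(deriv c θ * a (c θ)) / (φ (t * c θ) - z)) (fun t ht => ?_) ?_
      · rw [uIcc_of_le hT] at ht
        have h1 : HasDerivAt (fun t : ℝ => (t : ℂ) * c θ) (c θ) t := by
          simpa using (Complex.ofRealCLM.hasDerivAt (x := t)).mul_const (c θ)
        have h2 : HasDerivAt (fun t : ℝ => φ (t * c θ)) (deriv φ (t * c θ) * c θ) t :=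
          HasDerivAt.comp (h₂ := φ) t (h.holomorphic.differentiableAt
            (h.isOpen.mem_nhds (htΩ θ t ht.1))).hasDerivAt h1
        have h3 := (hasDerivAt_const t (-(deriv c θ * a (c θ)))).fun_div (h2.sub_const z)
          (hne z hz θ t ht.1)
        convert! h3 using 1
        ring
      · refine ContinuousOn.intervalIntegrable ?_
        rw [uIcc_of_le hT]
        have hφθ : ContinuousOn (fun t : ℝ => φ (t * c θ)) (Icc 1 T) :=
          h.holomorphic.continuousOn.comp (Continuous.continuousOn (by fun_prop))
            fun t ht => htΩ θ t ht.1
        have hdφθ : ContinuousOn (fun t : ℝ => deriv φ (t * c θ)) (Icc 1 T) :=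
          (h.holomorphic.deriv h.isOpen).continuousOn.comp (Continuous.continuousOn (by fun_prop))
            fun t ht => htΩ θ t ht.1
        exact (continuousOn_const.mul (hdφθ.mul continuousOn_const)).div
          ((hφθ.sub continuousOn_const).pow 2) fun t ht => pow_ne_zero 2 (hne z hz θ t ht.1)
    rw [integral_Icc_eq_integral_Ioc, ← intervalIntegral.integral_of_le hT, hftc]
    simp only [Complex.ofReal_one, one_mul]
    ring
  rwa [hval] at hder

/-- By Cauchy's formula `g` is a Cauchy integral. Moving its poles to `φ (T * w)` costs an exact
term, and the moved integral is holomorphic on a disk containing the domain. -/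
theorem isExactOn_innerDomain_of_lt (h : IsExteriorMap φ Ω r)
    (hg : DifferentiableOn ℂ g (innerDomain φ ρ)) (hrσ : r < σ) (hσρ : σ < ρ) :
    Complex.IsExactOn g (innerDomain φ σ) := by
  have hσ0 : 0 < σ := h.pos.trans hrσ
  obtain ⟨N, hN⟩ := (h.mono hrσ.le).isBounded_innerDomain.subset_ball 0
  obtain ⟨T₀, hT₀⟩ : ∃ T₀ : ℝ, ∀ w : ℂ, T₀ < ‖w‖ → N < ‖φ w‖ := by
    have h1 : ∀ᶠ w in cocompact ℂ, N < ‖φ w‖ :=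
      (tendsto_norm_cocompact_atTop.comp h.tendsto_infty).eventually_gt_atTop N
    obtain ⟨K, hK, hKs⟩ := mem_cocompact.1 h1
    obtain ⟨M, hM⟩ := hK.isBounded.subset_closedBall 0
    refine ⟨M, fun w hw => hKs fun hmem => ?_⟩
    exact absurd (mem_closedBall_zero_iff.1 (hM hmem)) (not_le.2 hw)
  -- Chosen so that `‖T * w‖ = σ + |T₀| > T₀` on the circle, which puts `φ (T * w)` outside the disk
  -- of radius `N`.
  set T : ℝ := 1 + |T₀| / σ with hT
  have hT1 : 1 ≤ T := by
    have : 0 ≤ |T₀| / σ := by positivity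
    linarith
  have hTw : ∀ w ∈ sphere (0 : ℂ) σ, σ ≤ ‖(T : ℂ) * w‖ ∧ N < ‖φ (T * w)‖ := by
    intro w hw
    have h1 : ‖(T : ℂ) * w‖ = σ + |T₀| := by
      rw [norm_mul, mem_sphere_zero_iff_norm.1 hw, Complex.norm_real,
        Real.norm_of_nonneg (by linarith), hT, add_mul, div_mul_cancel₀ _ hσ0.ne', one_mul]
    refine ⟨by rw [h1]; linarith [abs_nonneg T₀], hT₀ _ ?_⟩
    rw [h1]
    linarith [le_abs_self T₀]
  have ha : ContinuousOn (fun w => g (φ w) * deriv φ w) (sphere 0 σ) :=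
    (h.differentiableOn_pullback hg).continuousOn.mono (sphere_subset_annulus hrσ hσρ)
  obtain ⟨k₁, hk₁⟩ := h.isExactOn_circleIntegral_sub hrσ ha hT1
  have hball : DifferentiableOn ℂ
      (fun z => ∮ w in C(0, σ), g (φ w) * deriv φ w / (φ (T * w) - z)) (ball 0 N) := by
    intro z hz
    refine (differentiableAt_circleIntegral_div_sub (b := fun w => φ (T * w)) hσ0.le ha ?_
      ?_).differentiableWithinAt
    · exact h.holomorphic.continuousOn.comp (by fun_prop) fun w hw =>
        h.subset _ (hrσ.le.trans (hTw w hw).1)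
    · rintro ⟨w, hw, rfl⟩
      exact absurd (mem_ball_zero_iff.1 hz) (not_lt.2 (hTw w hw).2.le)
  obtain ⟨k₂, hk₂⟩ := hball.isExactOn_ball
  refine ⟨fun z => (2 * Real.pi * Complex.I)⁻¹ * (k₁ z + k₂ z), fun z hz => ?_⟩
  have := ((hk₁ z hz).add (hk₂ z (hN hz))).const_mul (2 * Real.pi * Complex.I)⁻¹
  convert! this using 1
  rw [sub_add_cancel, h.circleIntegral_eq hg hrσ hσρ hz, ← mul_assoc,
    inv_mul_cancel₀ Complex.two_pi_I_ne_zero, one_mul]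

theorem exists_mem_innerDomain_of_lt (h : IsExteriorMap φ Ω r) (hrρ : r < ρ) {z : ℂ}
    (hz : z ∈ innerDomain φ ρ) : ∃ σ, r < σ ∧ σ < ρ ∧ z ∈ innerDomain φ σ := by
  by_cases hzi : z ∈ φ '' {w | r ≤ ‖w‖}
  · obtain ⟨w, hw, rfl⟩ := hzi
    have hwρ : ‖w‖ < ρ := not_le.1 fun hcon => hz ⟨w, hcon, rfl⟩
    obtain ⟨σ, hwσ, hσρ⟩ := exists_between hwρ
    exact ⟨σ, lt_of_le_of_lt hw hwσ, hσρ, h.apply_mem_innerDomain hw hwσ⟩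
  · obtain ⟨σ, hrσ, hσρ⟩ := exists_between hrρ
    exact ⟨σ, hrσ, hσρ, innerDomain_mono hrσ.le hzi⟩

/-- At level `ρ` itself `g` need not extend to the boundary, so primitives on the smaller domains
are glued. Normalised to vanish at the common point `φ r`, they agree by connectedness. -/
theorem isExactOn_innerDomain (h : IsExteriorMap φ Ω r) (hrρ : r < ρ)
    (hg : DifferentiableOn ℂ g (innerDomain φ ρ)) : Complex.IsExactOn g (innerDomain φ ρ) := by
  set p : ℂ := φ r with hp
  have hpmem : ∀ σ, r < σ → p ∈ innerDomain φ σ := fun σ hσ => by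
    have hn : ‖(r : ℂ)‖ = r := by rw [Complex.norm_real, Real.norm_of_nonneg h.pos.le]
    exact h.apply_mem_innerDomain hn.ge (by rwa [hn])
  have hex : ∀ σ, r < σ → σ < ρ →
      ∃ k : ℂ → ℂ, k p = 0 ∧ ∀ z ∈ innerDomain φ σ, HasDerivAt k (g z) z :=
    fun σ hrσ hσρ => (h.isExactOn_innerDomain_of_lt hg hrσ hσρ).with_val_at p 0
  choose! k hkp hk using hex
  have hcompat : ∀ σ τ, r < σ → σ ≤ τ → τ < ρ → EqOn (k σ) (k τ) (innerDomain φ σ) := by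
    intro σ τ hrσ hστ hτρ z hz
    have hrτ := hrσ.trans_le hστ
    have hd : ∀ y ∈ innerDomain φ σ, HasDerivAt (fun y => k σ y - k τ y) 0 y := fun y hy => by
      simpa using (hk σ hrσ (hστ.trans_lt hτρ) y hy).fun_sub
        (hk τ hrτ hτρ y (innerDomain_mono hστ hy))
    have := (h.mono hrσ.le).isOpen_innerDomain.is_const_of_deriv_eq_zero
      (h.isPreconnected_innerDomain hrσ)
      (fun y hy => (hd y hy).differentiableAt.differentiableWithinAt)
      (fun y hy => (hd y hy).deriv) hz (hpmem σ hrσ)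
    simp only [hkp σ hrσ (hστ.trans_lt hτρ), hkp τ hrτ hτρ, sub_self] at this
    exact sub_eq_zero.1 this
  have hσ : ∀ z ∈ innerDomain φ ρ, ∃ σ, r < σ ∧ σ < ρ ∧ z ∈ innerDomain φ σ := fun z hz =>
    h.exists_mem_innerDomain_of_lt hrρ hz
  choose! σ hσ1 hσ2 hσ3 using hσ
  refine ⟨fun z => k (σ z) z, fun z hz => ?_⟩
  refine (hk (σ z) (hσ1 z hz) (hσ2 z hz) z (hσ3 z hz)).congr_of_eventuallyEq ?_
  filter_upwards [(h.mono (hσ1 z hz).le).isOpen_innerDomain.mem_nhds (hσ3 z hz)] with y hy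
  have hyρ : y ∈ innerDomain φ ρ := innerDomain_mono (hσ2 z hz).le hy
  rcases le_total (σ y) (σ z) with hle | hle
  · exact hcompat _ _ (hσ1 y hyρ) hle (hσ2 z hz) (hσ3 y hyρ)
  · exact (hcompat _ _ (hσ1 z hz) hle (hσ2 y hyρ) hy).symm

/-- If `k` is a primitive of `f' / f`, then `f * exp (-k)` is a constant `c ^ 2`, and `c * exp (k /
2)` is a square root. -/
theorem hasHolomorphicSqrt_innerDomain (h : IsExteriorMap φ Ω r) (hrρ : r < ρ) :
    HasHolomorphicSqrt (innerDomain φ ρ) := by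
  intro f hf hf0
  have hD : IsOpen (innerDomain φ ρ) := (h.mono hrρ.le).isOpen_innerDomain
  obtain ⟨k, hk⟩ := h.isExactOn_innerDomain hrρ ((hf.deriv hD).div hf hf0)
  have hd : ∀ z ∈ innerDomain φ ρ, HasDerivAt (fun y => f y * Complex.exp (-k y)) 0 z := by
    intro z hz
    have h1 := ((hf.differentiableAt (hD.mem_nhds hz)).hasDerivAt).mul (hk z hz).neg.cexp
    convert! h1 using 1
    have := hf0 z hz
    simp only [Pi.div_apply]
    field_simp
    ring
  rcases (innerDomain φ ρ).eq_empty_or_nonempty with he | ⟨p, hp⟩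
  · exact ⟨f, hf, by simp [he]⟩
  obtain ⟨c, hc⟩ : ∃ c : ℂ, c ^ 2 = f p * Complex.exp (-k p) :=
    IsAlgClosed.exists_pow_nat_eq _ two_pos
  refine ⟨fun z => c * Complex.exp (k z / 2), fun z hz => ?_, fun z hz => ?_⟩
  · exact (((hk z hz).differentiableAt.div_const 2).cexp.const_mul c).differentiableWithinAt
  · have := hD.is_const_of_deriv_eq_zero (h.isPreconnected_innerDomain hrρ)
      (fun y hy => (hd y hy).differentiableAt.differentiableWithinAt)
      (fun y hy => (hd y hy).deriv) hz hp
    rw [mul_pow, hc, ← this, ← Complex.exp_nat_mul, mul_assoc, ← Complex.exp_add]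
    have h2 : -k z + ((2 : ℕ) : ℂ) * (k z / 2) = 0 := by push_cast; ring
    rw [h2, Complex.exp_zero, mul_one]

/-- The domain inside the image of a circle is conformally a disk. -/
theorem exists_isConformalIso_innerDomain (h : IsExteriorMap φ Ω r) {p : ℂ}
    (hp : p ∈ innerDomain φ r) :
    ∃ f : ℂ → ℂ, IsConformalIso f (innerDomain φ r) (ball 0 1) ∧ f p = 0 := by
  obtain ⟨s, hsr, hs⟩ := h.exists_lt
  exact exists_isConformalIso_ball h.isOpen_innerDomain (hs.isPreconnected_innerDomain hsr)
    h.isBounded_innerDomain (hs.hasHolomorphicSqrt_innerDomain hsr) hp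

end IsExteriorMap

/-! ### Proper holomorphic maps of the disk -/

theorem norm_le_one_of_tendsto_norm {g : ℂ → ℂ} (hg : DifferentiableOn ℂ g (ball 0 1))
    (hlim : Tendsto (fun z => ‖g z‖) (comap (fun z : ℂ => ‖z‖) (𝓝[<] 1)) (𝓝 1)) {z : ℂ}
    (hz : z ∈ ball (0 : ℂ) 1) : ‖g z‖ ≤ 1 := by
  refine le_of_forall_pos_le_add fun ε hε => ?_
  obtain ⟨V, hV, hVs⟩ := mem_comap.1 (hlim.eventually_lt_const (show (1 : ℝ) < 1 + ε by linarith))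
  obtain ⟨s, hs, hsV⟩ := (mem_nhdsLT_iff_exists_Ioo_subset' (show (0 : ℝ) < 1 by norm_num)).1 hV
  obtain ⟨t, ht, ht1⟩ := exists_between
    (max_lt (max_lt (mem_Iio.1 hs) (mem_ball_zero_iff.1 hz)) (zero_lt_one' ℝ))
  have ht0 : 0 < t := (le_max_right _ _).trans_lt ht
  have hst : s < t := ((le_max_left _ _).trans (le_max_left _ _)).trans_lt ht
  have hzt : ‖z‖ < t := ((le_max_right _ _).trans (le_max_left _ _)).trans_lt ht
  refine Complex.norm_le_of_forall_mem_frontier_norm_le (isBounded_ball (x := (0 : ℂ)) (r := t))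
    (hg.diffContOnCl_ball (closedBall_subset_ball ht1)) (fun w hw => ?_)
    (subset_closure (mem_ball_zero_iff.2 hzt))
  rw [frontier_ball _ ht0.ne', mem_sphere_zero_iff_norm] at hw
  refine le_of_lt (hVs ?_)
  rw [mem_preimage, hw]
  exact hsV ⟨hst, ht1⟩

/-- The maximum principle bounds both `g` and `1 / g` by `1`, so `‖g‖` is identically `1` and `g` is
constant. -/
theorem exists_const_of_tendsto_norm {g : ℂ → ℂ} (hg : DifferentiableOn ℂ g (ball 0 1))
    (hg0 : ∀ z ∈ ball (0 : ℂ) 1, g z ≠ 0)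
    (hlim : Tendsto (fun z => ‖g z‖) (comap (fun z : ℂ => ‖z‖) (𝓝[<] 1)) (𝓝 1)) :
    ∃ c : ℂ, ‖c‖ = 1 ∧ ∀ z ∈ ball (0 : ℂ) 1, g z = c := by
  have hone : ∀ z ∈ ball (0 : ℂ) 1, ‖g z‖ = 1 := by
    intro z hz
    refine le_antisymm (norm_le_one_of_tendsto_norm hg hlim hz) ?_
    have h1 := norm_le_one_of_tendsto_norm (hg.inv hg0)
      (by simpa using hlim.inv₀ one_ne_zero) hz
    rw [Pi.inv_apply, norm_inv] at h1
    exact (inv_le_one₀ (norm_pos_iff.2 (hg0 z hz))).1 h1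
  have h0 : (0 : ℂ) ∈ ball (0 : ℂ) 1 := mem_ball_self one_pos
  exact ⟨g 0, hone 0 h0, fun z hz => Complex.eqOn_of_isPreconnected_of_isMaxOn_norm
    (convex_ball (0 : ℂ) 1).isPreconnected isOpen_ball hg h0
    (fun y hy => by simp [hone y hy, hone 0 h0]) hz⟩

namespace IsConformalIso

variable {h k : ℂ → ℂ} {U V : Set ℂ}

theorem image_eq (hh : IsConformalIso h U V) : h '' U = V := hh.bijOn.image_eq

theorem differentiableOn_inv (hh : IsConformalIso h U V) (hU : IsOpen U) :
    DifferentiableOn ℂ (Function.invFunOn h U) V := by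
  rw [← hh.image_eq]
  exact differentiableOn_invFunOn hU hh.holomorphic hh.bijOn.injOn

theorem mapsTo_inv (hh : IsConformalIso h U V) : MapsTo (Function.invFunOn h U) V U :=
  hh.bijOn.surjOn.mapsTo_invFunOn

theorem apply_inv (hh : IsConformalIso h U V) {y : ℂ} (hy : y ∈ V) :
    h (Function.invFunOn h U y) = y :=
  hh.bijOn.surjOn.rightInvOn_invFunOn hy

theorem inv_apply (hh : IsConformalIso h U V) {z : ℂ} (hz : z ∈ U) :
    Function.invFunOn h U (h z) = z :=
  hh.bijOn.injOn.leftInvOn_invFunOn hz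

theorem norm_lt_one (hh : IsConformalIso h U (ball 0 1)) {z : ℂ} (hz : z ∈ U) : ‖h z‖ < 1 :=
  mem_ball_zero_iff.1 (hh.bijOn.mapsTo hz)

theorem const_mul (hh : IsConformalIso h U (ball 0 1)) {c : ℂ} (hc : ‖c‖ = 1) :
    IsConformalIso (fun z => c * h z) U (ball 0 1) := by
  have hc0 : c ≠ 0 := norm_ne_zero_iff.1 (by rw [hc]; exact one_ne_zero)
  refine ⟨hh.holomorphic.const_mul c, fun z hz => ?_, fun x hx y hy hxy => ?_, fun y hy => ?_⟩
  · simpa [hc] using hh.norm_lt_one hz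
  · exact hh.bijOn.injOn hx hy (mul_left_cancel₀ hc0 hxy)
  · obtain ⟨z, hz, hzy⟩ := hh.bijOn.surjOn
      (show c⁻¹ * y ∈ ball (0 : ℂ) 1 by simpa [hc] using hy)
    exact ⟨z, hz, by simp only [hzy]; field_simp⟩

/-- The Schwarz lemma for nested domains. -/
theorem norm_le_norm (hh : IsConformalIso h U (ball 0 1)) (hk : IsConformalIso k V (ball 0 1))
    (hU : IsOpen U) (hUV : U ⊆ V) {p : ℂ} (hp : p ∈ U) (hhp : h p = 0) (hkp : k p = 0) {z : ℂ}
    (hz : z ∈ U) : ‖k z‖ ≤ ‖h z‖ := by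
  have hd : DifferentiableOn ℂ (fun y => k (Function.invFunOn h U y)) (ball 0 1) :=
    hk.holomorphic.comp (hh.differentiableOn_inv hU) fun y hy => hUV (hh.mapsTo_inv hy)
  have h1 := Complex.norm_le_norm_of_mapsTo_ball hd
    (fun y hy => ball_subset_closedBall (hk.bijOn.mapsTo (hUV (hh.mapsTo_inv hy))))
    (by
      have h0 := hh.inv_apply hp
      rw [hhp] at h0
      rw [h0, hkp]) (hh.norm_lt_one hz)
  simpa only [hh.inv_apply hz] using h1

/-- This is properness: because `U` is the full preimage of `V` and is bounded, the preimage of a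
compact subset of `V` is a compact subset of `U`. Points near the unit circle avoid its image under
`h`. -/
theorem tendsto_norm_of_preimage (hh : IsConformalIso h U (ball 0 1))
    (hk : IsConformalIso k V (ball 0 1)) (hV : IsOpen V) (hUb : Bornology.IsBounded U)
    {f : ℂ → ℂ} (hf : Continuous f) (hfUV : ∀ z, f z ∈ V ↔ z ∈ U) :
    Tendsto (fun y => ‖k (f (Function.invFunOn h U y))‖) (comap (fun z : ℂ => ‖z‖) (𝓝[<] 1))
      (𝓝 1) := by
  have hev : ∀ᶠ z : ℂ in comap (fun z : ℂ => ‖z‖) (𝓝[<] 1), ‖z‖ < 1 :=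
    tendsto_comap.eventually self_mem_nhdsWithin
  rw [tendsto_order]
  refine ⟨fun t ht => ?_, fun t ht => ?_⟩
  · set K := Function.invFunOn k V '' closedBall 0 t with hK
    have hKc : IsCompact K := (isCompact_closedBall (0 : ℂ) t).image_of_continuousOn
      ((hk.differentiableOn_inv hV).continuousOn.mono (closedBall_subset_ball ht))
    have hKV : K ⊆ V := by
      rintro _ ⟨y, hy, rfl⟩
      exact hk.mapsTo_inv (closedBall_subset_ball ht hy)
    have hpreU : f ⁻¹' K ⊆ U := fun z hz => (hfUV z).1 (hKV hz)
    have hprec : IsCompact (f ⁻¹' K) :=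
      isCompact_of_isClosed_isBounded (hKc.isClosed.preimage hf) (hUb.subset hpreU)
    have hc2 : IsCompact (h '' (f ⁻¹' K)) :=
      hprec.image_of_continuousOn (hh.holomorphic.continuousOn.mono hpreU)
    obtain ⟨s, hs1, hs⟩ : ∃ s < (1 : ℝ), ∀ y ∈ h '' (f ⁻¹' K), ‖y‖ ≤ s := by
      rcases (h '' (f ⁻¹' K)).eq_empty_or_nonempty with he | hne
      · exact ⟨0, one_pos, by simp [he]⟩
      · obtain ⟨y, ⟨z, hz, rfl⟩, hy⟩ := hc2.exists_isMaxOn hne continuous_norm.continuousOn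
        exact ⟨‖h z‖, hh.norm_lt_one (hpreU hz), fun w hw => hy hw⟩
    have hevs : ∀ᶠ z : ℂ in comap (fun z : ℂ => ‖z‖) (𝓝[<] 1), s < ‖z‖ :=
      tendsto_comap.eventually ((eventually_gt_nhds hs1).filter_mono nhdsWithin_le_nhds)
    filter_upwards [hev, hevs] with y hy1 hys
    by_contra hcon
    have hyb : y ∈ ball (0 : ℂ) 1 := mem_ball_zero_iff.2 hy1
    have hyU := hh.mapsTo_inv hyb
    refine absurd (hs y ⟨Function.invFunOn h U y, ?_, hh.apply_inv hyb⟩) (not_le.2 hys)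
    exact ⟨k (f (Function.invFunOn h U y)), mem_closedBall_zero_iff.2 (not_lt.1 hcon),
      hk.inv_apply ((hfUV _).2 hyU)⟩
  · filter_upwards [hev] with y hy1
    exact (hk.norm_lt_one ((hfUV _).2 (hh.mapsTo_inv (mem_ball_zero_iff.2 hy1)))).trans ht

/-- A polynomial which restricts to a proper map between two simply connected domains is a Blaschke
product in the Riemann coordinates. -/
theorem exists_eq_prod_blaschkeFactor (hh : IsConformalIso h U (ball 0 1))
    (hk : IsConformalIso k V (ball 0 1)) (hU : IsOpen U) (hV : IsOpen V)
    (hUb : Bornology.IsBounded U) {P : Polynomial ℂ} (hP : P.natDegree ≠ 0)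
    (hPUV : ∀ z, P.eval z ∈ V ↔ z ∈ U) {p : ℂ} (hp : p ∈ V) (hkp : k p = 0) :
    ∃ c : ℂ, ‖c‖ = 1 ∧ ∀ z ∈ U, k (P.eval z) =
      c * ((P - Polynomial.C p).roots.map fun q => blaschkeFactor (h q) (h z)).prod := by
  set Q := P - Polynomial.C p with hQ
  have hQdeg : Q.natDegree = P.natDegree := Polynomial.natDegree_sub_C
  have hQ0 : Q ≠ 0 := fun h0 => hP (by rw [← hQdeg, h0, Polynomial.natDegree_zero])
  have hrootsU : ∀ q ∈ Q.roots, q ∈ U := by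
    intro q hq
    have h1 := (Polynomial.mem_roots hQ0).1 hq
    rw [Polynomial.IsRoot, hQ, Polynomial.eval_sub, Polynomial.eval_C, sub_eq_zero] at h1
    rw [← hPUV, h1]
    exact hp
  have hQeval : ∀ z, P.eval z - p = Q.leadingCoeff * (Q.roots.map fun q => z - q).prod := by
    intro z
    have h1 := IsAlgClosed.splits Q
    have h2 := congrArg (Polynomial.eval z) h1.eq_prod_roots
    rw [Polynomial.eval_mul, Polynomial.eval_C, Polynomial.eval_multiset_prod,
      Multiset.map_map] at h2
    simpa [hQ] using h2
  -- The Möbius factor with its zero divided out: `blaschkeFactor (h q) (h z) = A q z * (z - q)`,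
  -- with `A q` zero-free on `U`.
  set A : ℂ → ℂ → ℂ := fun q z => dslope h q z / (1 - (starRingEnd ℂ) (h q) * h z) with hA
  have hden : ∀ q ∈ U, ∀ z ∈ U, 1 - (starRingEnd ℂ) (h q) * h z ≠ 0 := fun q hq z hz =>
    one_sub_conj_mul_ne_zero (hh.norm_lt_one hq) (hh.norm_lt_one hz).le
  have hAd : ∀ q ∈ U, DifferentiableOn ℂ (A q) U := fun q hq =>
    ((Complex.differentiableOn_dslope (hU.mem_nhds hq)).2 hh.holomorphic).div
      ((hh.holomorphic.const_mul _).const_sub _) (hden q hq)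
  have hA0 : ∀ q ∈ U, ∀ z ∈ U, A q z ≠ 0 := fun q hq z hz =>
    div_ne_zero (dslope_ne_zero_of_injOn hU hh.holomorphic hh.bijOn.injOn hq hz) (hden q hq z hz)
  have hAB : ∀ q z, blaschkeFactor (h q) (h z) = A q z * (z - q) := by
    intro q z
    have h1 := sub_smul_dslope h q z
    rw [smul_eq_mul] at h1
    rw [blaschkeFactor, ← h1]
    simp only [hA]
    ring
  have hprodd : ∀ s : Multiset ℂ, (∀ q ∈ s, q ∈ U) →
      DifferentiableOn ℂ (fun z => (s.map fun q => A q z).prod) U ∧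
        ∀ z ∈ U, (s.map fun q => A q z).prod ≠ 0 := by
    intro s
    induction s using Multiset.induction_on with
    | empty => intro _; exact ⟨by simp, by simp⟩
    | cons q s ih =>
      intro hs
      obtain ⟨ih1, ih2⟩ := ih fun x hx => hs x (Multiset.mem_cons_of_mem hx)
      have hq := hs q (Multiset.mem_cons_self q s)
      simp only [Multiset.map_cons, Multiset.prod_cons]
      exact ⟨(hAd q hq).mul ih1, fun z hz => mul_ne_zero (hA0 q hq z hz) (ih2 z hz)⟩
  obtain ⟨hpd, hp0⟩ := hprodd Q.roots hrootsU
  -- The quotient of `k ∘ P` by the Blaschke product, written after cancelling the common factor `∏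
  -- (z - q)`, so that it is visibly holomorphic and zero-free, multiple roots included.
  set G : ℂ → ℂ := fun z => Q.leadingCoeff * dslope k p (P.eval z) /
    (Q.roots.map fun q => A q z).prod with hG
  have hPm : MapsTo (fun z => P.eval z) U V := fun z hz => (hPUV z).2 hz
  have hGd : DifferentiableOn ℂ G U :=
    ((((Complex.differentiableOn_dslope (hV.mem_nhds hp)).2 hk.holomorphic).comp
      P.differentiable.differentiableOn hPm).const_mul _).div hpd hp0
  have hG0 : ∀ z ∈ U, G z ≠ 0 := fun z hz =>
    div_ne_zero (mul_ne_zero (Polynomial.leadingCoeff_ne_zero.2 hQ0)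
      (dslope_ne_zero_of_injOn hV hk.holomorphic hk.bijOn.injOn hp (hPm hz))) (hp0 z hz)
  have hGeq : ∀ z ∈ U, k (P.eval z) =
      G z * (Q.roots.map fun q => blaschkeFactor (h q) (h z)).prod := by
    intro z hz
    have h1 := sub_smul_dslope k p (P.eval z)
    rw [smul_eq_mul, hkp, sub_zero, hQeval] at h1
    simp only [hAB, hG]
    rw [Multiset.prod_map_mul, ← h1]
    have := hp0 z hz
    field_simp
  have hBlim : ∀ s : Multiset ℂ, (∀ q ∈ s, q ∈ U) →
      Tendsto (fun y => ‖(s.map fun q => blaschkeFactor (h q) y).prod‖)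
        (comap (fun z : ℂ => ‖z‖) (𝓝[<] 1)) (𝓝 1) := by
    intro s
    induction s using Multiset.induction_on with
    | empty => intro _; simp [tendsto_const_nhds]
    | cons q s ih =>
      intro hs
      have ih' := ih fun x hx => hs x (Multiset.mem_cons_of_mem hx)
      have hq := hs q (Multiset.mem_cons_self q s)
      simp only [Multiset.map_cons, Multiset.prod_cons, norm_mul]
      simpa using (tendsto_norm_blaschkeFactor (hh.norm_lt_one hq)).mul ih'
  have hkP := hh.tendsto_norm_of_preimage hk hV hUb P.continuous hPUV
  have hquot := hkP.div (hBlim Q.roots hrootsU) one_ne_zero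
  have hev : ∀ᶠ z : ℂ in comap (fun z : ℂ => ‖z‖) (𝓝[<] 1), ‖z‖ < 1 :=
    tendsto_comap.eventually self_mem_nhdsWithin
  have hglim : Tendsto (fun y => ‖G (Function.invFunOn h U y)‖)
      (comap (fun z : ℂ => ‖z‖) (𝓝[<] 1)) (𝓝 1) := by
    rw [div_one] at hquot
    refine hquot.congr' ?_
    filter_upwards [hev, (hBlim Q.roots hrootsU).eventually_ne one_ne_zero] with y hy hne
    have hyb : y ∈ ball (0 : ℂ) 1 := mem_ball_zero_iff.2 hy
    rw [Pi.div_apply, hGeq _ (hh.mapsTo_inv hyb), norm_mul, hh.apply_inv hyb,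
      mul_div_cancel_right₀ _ hne]
  obtain ⟨c, hc, hcg⟩ := exists_const_of_tendsto_norm
    (hGd.comp (hh.differentiableOn_inv hU) hh.mapsTo_inv)
    (fun y hy => hG0 _ (hh.mapsTo_inv hy)) hglim
  refine ⟨c, hc, fun z hz => ?_⟩
  rw [hGeq z hz, ← hcg (h z) (hh.bijOn.mapsTo hz), Function.comp_apply, hh.inv_apply hz]

end IsConformalIso

/-! ### Blaschke products -/

theorem mul_blaschkeFactor {c : ℂ} (hc : ‖c‖ = 1) (a z : ℂ) :
    c * blaschkeFactor a z = blaschkeFactor (c * a) (c * z) := by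
  have h1 : (starRingEnd ℂ) c * c = 1 := by
    rw [Complex.conj_mul', hc]
    norm_num
  rw [blaschkeFactor, blaschkeFactor, map_mul,
    show (starRingEnd ℂ) c * (starRingEnd ℂ) a * (c * z) =
      ((starRingEnd ℂ) c * c) * ((starRingEnd ℂ) a * z) by ring, h1]
  ring

theorem IsNormalizedBlaschke.isBlaschkeProduct {d : ℕ} {a : Fin (d - 1) → ℂ} {b : ℂ → ℂ}
    (hb : IsNormalizedBlaschke d a b) : IsBlaschkeProduct d b := by
  cases d with
  | zero => exact absurd hb.two_le (by norm_num)
  | succ m =>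
    refine ⟨0, Fin.cons 0 a, fun k => ?_, fun z hz => ?_⟩
    · refine Fin.cases ?_ (fun i => ?_) k
      · simp
      · exact hb.norm_lt_one i
    · rw [hb.eq_prod z hz, Fin.prod_univ_succ]
      simp [blaschkeFactor]

theorem differentiableOn_prod_blaschkeFactor {m : ℕ} {a : Fin m → ℂ} (ha : ∀ k, ‖a k‖ < 1) :
    DifferentiableOn ℂ (fun z => z * ∏ k, blaschkeFactor (a k) z) (ball 0 1) :=
  differentiableOn_id.mul (DifferentiableOn.fun_finsetProd fun k _ =>
    differentiableOn_blaschkeFactor (ha k))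

theorem mapsTo_prod_blaschkeFactor {m : ℕ} {a : Fin m → ℂ} (ha : ∀ k, ‖a k‖ < 1) :
    MapsTo (fun z => z * ∏ k, blaschkeFactor (a k) z) (ball 0 1) (ball 0 1) := by
  intro z hz
  rw [mem_ball_zero_iff] at hz ⊢
  rw [norm_mul, norm_prod]
  have h1 : ∏ k, ‖blaschkeFactor (a k) z‖ ≤ 1 := Finset.prod_le_one
    (fun _ _ => norm_nonneg _) fun k _ => (norm_blaschkeFactor_lt_one (ha k) hz).le
  nlinarith [norm_nonneg z]

theorem exists_map_univ_eq {α : Type*} {m : ℕ} (s : Multiset α) (hs : s.card = m) :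
    ∃ q : Fin m → α, s = Finset.univ.val.map q := by
  obtain ⟨l, rfl⟩ : ∃ l : List α, (l : Multiset α) = s := Quot.exists_rep s
  rw [Multiset.coe_card] at hs
  subst hs
  exact ⟨l.get, by rw [Fin.univ_val_map, List.ofFn_get]⟩

/-! ### Böttcher maps -/

namespace IsBottcherMap

variable {P : Polynomial ℂ} {Ω : Set ℂ} {φ : ℂ → ℂ} {R ρ : ℝ}

theorem isExteriorMap (hφ : IsBottcherMap P Ω φ) (hR : 0 < R) (hΩ : ∀ w : ℂ, R ≤ ‖w‖ → w ∈ Ω) :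
    IsExteriorMap φ Ω R :=
  ⟨hR, hφ.isOpen, hΩ, hφ.holomorphic, hφ.injOn, hφ.tendsto_infty⟩

/-- The direction with content is a count: for `‖v‖ ≥ ρ ^ d` the `d` distinct roots of `w ^ d = v`
give `d` distinct solutions `φ w` of `P y = φ v`, which are therefore all the solutions. -/
theorem eval_mem_innerDomain_iff (hφ : IsBottcherMap P Ω φ) (hP : P.natDegree ≠ 0) (hρ : 1 < ρ)
    (hΩ : ∀ w : ℂ, ρ ≤ ‖w‖ → w ∈ Ω) (z : ℂ) :
    P.eval z ∈ innerDomain φ (ρ ^ P.natDegree) ↔ z ∈ innerDomain φ ρ := by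
  classical
  set d := P.natDegree with hd
  have hρd : ρ ≤ ρ ^ d := le_self_pow₀ hρ.le hP
  unfold innerDomain
  rw [mem_compl_iff, mem_compl_iff, not_iff_not]
  constructor
  · rintro ⟨v, hv, hvz⟩
    have hv' : ρ ^ d ≤ ‖v‖ := hv
    have hv0 : v ≠ 0 := norm_pos_iff.1 ((pow_pos (by linarith) d).trans_le hv')
    have hprim := Complex.isPrimitiveRoot_exp d hP
    have hcard := hprim.card_nthRoots v
    rw [if_pos (IsAlgClosed.exists_pow_nat_eq v (Nat.pos_of_ne_zero hP))] at hcard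
    have hnodup := hprim.nthRoots_nodup hv0
    have hmem : ∀ w ∈ (Polynomial.nthRoots d v).toFinset, ρ ≤ ‖w‖ ∧ P.eval (φ w) = φ v := by
      intro w hw
      have hwd : w ^ d = v :=
        (Polynomial.mem_nthRoots (Nat.pos_of_ne_zero hP)).1 (Multiset.mem_toFinset.1 hw)
      have hwρ : ρ ≤ ‖w‖ := by
        rw [← hwd, norm_pow] at hv'
        exact le_of_pow_le_pow_left₀ hP (norm_nonneg w) hv'
      refine ⟨hwρ, ?_⟩
      rw [← hφ.conj w (hΩ w hwρ) (by rw [← hd, hwd]; exact hΩ v (hρd.trans hv')), ← hd, hwd]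
    set Q := P - Polynomial.C (φ v) with hQ
    have hQdeg : Q.natDegree = d := Polynomial.natDegree_sub_C
    have hQ0 : Q ≠ 0 := fun h0 => hP (by rw [← hQdeg, h0, Polynomial.natDegree_zero])
    have hQroot : ∀ y, y ∈ Q.roots.toFinset ↔ P.eval y = φ v := by
      intro y
      rw [Multiset.mem_toFinset, Polynomial.mem_roots hQ0, Polynomial.IsRoot, hQ,
        Polynomial.eval_sub, Polynomial.eval_C, sub_eq_zero]
    have hsub : (Polynomial.nthRoots d v).toFinset.image φ ⊆ Q.roots.toFinset := by
      intro y hy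
      obtain ⟨w, hw, rfl⟩ := Finset.mem_image.1 hy
      exact (hQroot _).2 (hmem w hw).2
    have hcard2 : ((Polynomial.nthRoots d v).toFinset.image φ).card = d := by
      rw [Finset.card_image_of_injOn, Multiset.toFinset_card_of_nodup hnodup, hcard]
      intro x hx y hy hxy
      exact hφ.injOn (hΩ x (hmem x hx).1) (hΩ y (hmem y hy).1) hxy
    have hle : Q.roots.toFinset.card ≤ ((Polynomial.nthRoots d v).toFinset.image φ).card := by
      rw [hcard2, ← hQdeg]
      exact (Multiset.toFinset_card_le _).trans (Polynomial.card_roots' Q)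
    have heq := Finset.eq_of_subset_of_card_le hsub hle
    have hz : z ∈ (Polynomial.nthRoots d v).toFinset.image φ := by
      rw [heq, hQroot, hvz]
    obtain ⟨w, hw, rfl⟩ := Finset.mem_image.1 hz
    exact ⟨w, (hmem w hw).1, rfl⟩
  · rintro ⟨w, hw, rfl⟩
    have hw' : ρ ≤ ‖w‖ := hw
    have hwd : ρ ^ d ≤ ‖w ^ d‖ := by
      rw [norm_pow]
      exact pow_le_pow_left₀ (by linarith) hw' d
    exact ⟨w ^ d, hwd, hφ.conj w (hΩ w hw') (hΩ _ (hρd.trans hwd))⟩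

theorem exists_eval_eq_self (hP : 2 ≤ P.natDegree) : ∃ p : ℂ, P.eval p = p := by
  have hdeg : (P - Polynomial.X).degree ≠ 0 := by
    have h1 : (P - Polynomial.X).natDegree = P.natDegree :=
      Polynomial.natDegree_sub_eq_left_of_natDegree_lt (by rw [Polynomial.natDegree_X]; omega)
    intro h0
    have h2 : (P - Polynomial.X).natDegree = 0 := Polynomial.natDegree_eq_of_degree_eq_some h0
    omega
  obtain ⟨p, hp⟩ := IsAlgClosed.exists_root _ hdeg
  refine ⟨p, ?_⟩
  rwa [Polynomial.IsRoot, Polynomial.eval_sub, Polynomial.eval_X, sub_eq_zero] at hp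

/-- A fixed point `φ w` with `‖w‖ ≥ R > 1` would give `w ^ d = w` by injectivity, although `‖w ^ d‖
> ‖w‖`. -/
theorem mem_innerDomain_of_eval_eq_self (hφ : IsBottcherMap P Ω φ) (hP : 2 ≤ P.natDegree)
    (hR : 1 < R) (hΩ : ∀ w : ℂ, R ≤ ‖w‖ → w ∈ Ω) {p : ℂ} (hp : P.eval p = p) :
    p ∈ innerDomain φ R := by
  rintro ⟨w, hw, rfl⟩
  have hw1 : 1 < ‖w‖ := lt_of_lt_of_le hR hw
  have hlt : ‖w‖ < ‖w ^ P.natDegree‖ := by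
    rw [norm_pow]
    exact lt_self_pow₀ hw1 hP
  have hwΩ' := hΩ _ ((show R ≤ ‖w‖ from hw).trans hlt.le)
  have := hφ.injOn hwΩ' (hΩ w hw) ((hφ.conj w (hΩ w hw) hwΩ').trans hp)
  rw [this] at hlt
  exact lt_irrefl _ hlt

end IsBottcherMap

end PolyBlaschke

open PolyBlaschke in
theorem mainTheorem9 (P : Polynomial ℂ) (d : ℕ) (hd : P.natDegree = d) (hd2 : 2 ≤ d)
    (Ω : Set ℂ) (φ : ℂ → ℂ) (hφ : IsBottcherMap P Ω φ)
    (R : ℝ) (hR : 1 < R) (hΩ : ∀ w : ℂ, R ≤ ‖w‖ → w ∈ Ω) :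
    ∃ b : ℕ → ℂ → ℂ,
      (∀ n, IsBlaschkeProduct d (b n)) ∧
      UniformlyHyperbolic b ∧
      ConformallyEquivalent
        (equipotentialDomain φ d R) (fun _ z => P.eval z)
        (fun _ => Metric.ball (0 : ℂ) 1) b := by
  subst hd
  set d := P.natDegree with hd
  have hd0 : d ≠ 0 := by omega
  set ρ : ℕ → ℝ := fun n => R ^ d ^ n with hρ
  have hρR : ∀ n, R ≤ ρ n := fun n => le_self_pow₀ hR.le (pow_ne_zero n hd0)
  have hρsucc : ∀ n, ρ (n + 1) = ρ n ^ d := fun n => by simp only [hρ]; rw [pow_succ, pow_mul]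
  have hext : ∀ n, IsExteriorMap φ Ω (ρ n) := fun n =>
    (hφ.isExteriorMap (zero_lt_one.trans hR) hΩ).mono (hρR n)
  have hDn : ∀ n, equipotentialDomain φ d R n = innerDomain φ (ρ n) := fun n =>
    (hext n).curveInterior_image_sphere
  have hDo : ∀ n, IsOpen (innerDomain φ (ρ n)) := fun n => (hext n).isOpen_innerDomain
  have hPD : ∀ n z, P.eval z ∈ innerDomain φ (ρ (n + 1)) ↔ z ∈ innerDomain φ (ρ n) := fun n z => by
    rw [hρsucc]
    exact hφ.eval_mem_innerDomain_iff hd0 (hR.trans_le (hρR n)) (hext n).subset z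
  obtain ⟨p, hp⟩ := IsBottcherMap.exists_eval_eq_self (P := P) hd2
  have hpR := hφ.mem_innerDomain_of_eval_eq_self hd2 hR hΩ hp
  have hpD : ∀ n, p ∈ innerDomain φ (ρ n) := fun n => IsExteriorMap.innerDomain_mono (hρR n) hpR
  choose h hh hhp using fun n => (hext n).exists_isConformalIso_innerDomain (hpD n)
  choose c hc hcP using fun n => (hh n).exists_eq_prod_blaschkeFactor (hh (n + 1)) (hDo n)
    (hDo (n + 1)) (hext n).isBounded_innerDomain hd0 (hPD n) (hpD (n + 1)) (hhp (n + 1))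
  set Q := P - Polynomial.C p with hQ
  have hQdeg : Q.natDegree = d := Polynomial.natDegree_sub_C
  have hQ0 : Q ≠ 0 := fun h0 => hd0 (by rw [← hQdeg, h0, Polynomial.natDegree_zero])
  have hQroot : ∀ y, y ∈ Q.roots ↔ P.eval y = p := fun y => by
    rw [Polynomial.mem_roots hQ0, Polynomial.IsRoot, hQ, Polynomial.eval_sub, Polynomial.eval_C,
      sub_eq_zero]
  -- One copy of the root `p` becomes the factor `z`. The remaining `d - 1` roots may contain `p`
  -- again, with multiplicity.
  obtain ⟨s, hs⟩ := Multiset.exists_cons_of_mem ((hQroot p).2 hp)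
  have hscard : s.card = d - 1 := by
    have h1 := (Polynomial.splits_iff_card_roots).1 (IsAlgClosed.splits Q)
    rw [hs, Multiset.card_cons, hQdeg] at h1
    omega
  obtain ⟨q, hq⟩ := exists_map_univ_eq s hscard
  have hqD0 : ∀ k, q k ∈ innerDomain φ (ρ 0) := fun k => by
    rw [← hPD, (hQroot (q k)).1 (by
      rw [hs, hq]
      exact Multiset.mem_cons_of_mem (Multiset.mem_map_of_mem q (Finset.mem_univ k)))]
    exact hpD _
  have hD0n : ∀ n, innerDomain φ (ρ 0) ⊆ innerDomain φ (ρ n) := fun n =>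
    IsExteriorMap.innerDomain_mono (by simpa [hρ] using hρR n)
  have hnorm : ∀ n k, ‖h n (q k)‖ ≤ ‖h 0 (q k)‖ := fun n k =>
    (hh 0).norm_le_norm (hh n) (hDo 0) (hD0n n) (hpD 0) (hhp 0) (hhp n) (hqD0 k)
  -- Rotations with `lam (n + 1) * c n = lam n ^ d`: each of the `d` factors of the Blaschke product
  -- absorbs one `lam n`, so no constant is left after replacing `h n` by `lam n * h n`.
  let lam : ℕ → ℂ := fun n => Nat.rec 1 (fun n l => (starRingEnd ℂ) (c n) * l ^ d) n
  have hlsucc : ∀ n, lam (n + 1) = (starRingEnd ℂ) (c n) * lam n ^ d := fun n => rfl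
  have hlam : ∀ n, ‖lam n‖ = 1 := by
    intro n
    induction n with
    | zero => exact norm_one
    | succ n ih => rw [hlsucc, norm_mul, RCLike.norm_conj, hc, norm_pow, ih, one_pow, one_mul]
  set a : ℕ → Fin (d - 1) → ℂ := fun n k => lam n * h n (q k) with ha
  have haeq : ∀ n k, ‖a n k‖ = ‖h n (q k)‖ := fun n k => by
    simp only [ha]
    rw [norm_mul, hlam, one_mul]
  have ha1 : ∀ n k, ‖a n k‖ < 1 := fun n k => by
    rw [haeq]
    exact (hh n).norm_lt_one (hD0n n (hqD0 k))
  set b : ℕ → ℂ → ℂ := fun n z => z * ∏ k, blaschkeFactor (a n k) z with hb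
  have hnb : ∀ n, IsNormalizedBlaschke d (a n) (b n) := fun n => ⟨hd2, ha1 n, fun z _ => rfl⟩
  have hD : equipotentialDomain φ d R = fun n => innerDomain φ (ρ n) := funext hDn
  refine ⟨b, fun n => (hnb n).isBlaschkeProduct, ⟨fun _ => d, a, hnb, ⟨d, fun _ => le_rfl⟩, ?_⟩, ?_⟩
  -- Only finitely many numbers `‖h 0 (q k)‖ < 1` occur, so some `t < 1` exceeds them all; by the
  -- Schwarz comparison it works for every `n`.
  · have hev : ∀ᶠ t in 𝓝[<] (1 : ℝ), (∀ k, ‖h 0 (q k)‖ < t) ∧ 0 < t := by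
      refine Filter.Eventually.and (eventually_all.2 fun k => ?_) ?_
      · exact (eventually_gt_nhds ((hh 0).norm_lt_one (hqD0 k))).filter_mono nhdsWithin_le_nhds
      · exact (eventually_gt_nhds one_pos).filter_mono nhdsWithin_le_nhds
    obtain ⟨t, ⟨ht, ht0⟩, ht1⟩ := (hev.and self_mem_nhdsWithin).exists
    exact ⟨t, ht0, ht1, fun n k => by rw [haeq]; exact (hnorm n k).trans_lt (ht k)⟩
  · rw [hD]
    refine ⟨⟨hDo, fun n => P.differentiable.differentiableOn, fun n z hz => (hPD n z).2 hz⟩,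
      ⟨fun _ => isOpen_ball, fun n => differentiableOn_prod_blaschkeFactor (ha1 n),
        fun n => mapsTo_prod_blaschkeFactor (ha1 n)⟩,
      fun n z => lam n * h n z, fun n => (hh n).const_mul (hlam n), fun n z hz => ?_⟩
    have hcc : (starRingEnd ℂ) (c n) * c n = 1 := by
      rw [Complex.conj_mul', hc]
      norm_num
    have hprod : (s.map fun q => blaschkeFactor (h n q) (h n z)).prod =
        ∏ k, blaschkeFactor (h n (q k)) (h n z) := by
      rw [hq, Multiset.map_map]
      rfl
    simp only [hb, ha]
    rw [hcP n z hz, hs, Multiset.map_cons, Multiset.prod_cons, hprod, hhp n, hlsucc]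
    simp only [← mul_blaschkeFactor (hlam n)]
    rw [Finset.prod_mul_distrib, Finset.prod_const, Finset.card_univ, Fintype.card_fin]
    have hpow : lam n ^ d = lam n * lam n ^ (d - 1) := by
      rw [← pow_succ', Nat.sub_add_cancel (by omega)]
    have hb0 : blaschkeFactor 0 (h n z) = h n z := by simp [blaschkeFactor]
    rw [hpow, hb0]
    linear_combination (-(lam n * lam n ^ (d - 1) * h n z *
      ∏ k, blaschkeFactor (h n (q k)) (h n z))) * hcc
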